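/- **Setting.** Let $\mathsf X$ and $\mathsf Y$ be measurable spaces. Consider a hidden Markov model on $\mathsf X\times\mathsf Y$ with initial law $\pi_0$, Markov transition kernels $(K_t)_{t\ge 1}$ on $\mathsf X$, and strictly positive, jointly measurable observation densities $g_t(x,\cdot)$, $t\ge 0$, with respect to a $\sigma$-finite measure on $\mathsf Y$. For a fixed sequence of observations $y=(y_t)_{t\ge0}$ write $g_t(x)=g_t(x,y_t)$, and define the probability measures $\pi_T$, $T\ge 0$, by $$\pi_T(\varphi)=\frac1{Z_T}\int_{\mathsf X^{T+1}}\pi_0(\mathrm dx_0)\prod_{t=1}^TK_t(x_{t-1},\mathrm dx_t)\prod_{t=0}^{T-1}g_t(x_t)\,\varphi(x_T),$$ where $Z_T$ is the normalising constant. *Assumption.* There are constants $\kappa_K,\kappa_g>0$ such that, for every $t\ge1$, the kernel $K_t$ has a density with respect to some $\sigma$-finite measure on $\mathsf X$ taking values in $[\kappa_K^{-1},\kappa_K]$ and, for every $t\ge0$ and $x\in\mathsf X$, $\kappa_g^{-1}\le g_t(x)\le\kappa_g$. *The $\alpha$-SMC algorithm.* Let $N\ge1$ and let $\alpha\in\mathbb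 R^{N\times N}$ be bi-stochastic. The particles $X_0^1,\dots,X_0^N$ are i.i.d. with law $\pi_0$, and $W_0^i=1$ for all $i$. For $t\ge1$, $$W_t^i=\sum_{j=1}^N\alpha^{ij}W_{t-1}^jg_{t-1}(X_{t-1}^j),$$ and, conditionally on the $\sigma$-algebra generated by all particles up to time $t-1$, the particles $X_t^1,\dots,X_t^N$ are independent, $X_t^i$ having law $$\frac1{W_t^i}\sum_{j=1}^N\alpha^{ij}W_{t-1}^jg_{t-1}(X_{t-1}^j)K_t(X_{t-1}^j,\cdot).$$ Set $$\widehat\pi_t^N=\sum_{i=1}^N\frac{W_t^i}{\sum_{j}W_t^j}\,\delta_{X_t^i}.$$ *Notation.* For random probability measures $\mu,\nu$ on $\mathsf X$, let $|||\mu-\nu|||^2=\sup_\varphi\mathbb E[(\mu(\varphi)-\nu(\varphi))^2]$, where the supremum is over all measurable $\varphi:\mathsf X\to\mathbb R$ with $|\varphi|\le1$. Let $\lambda(\alpha)=\sup\{\|\alpha v\|:v\in\mathbb R^N,\ \|v\|=1,\ \langle v,\mathbf 1\rangle=0\}$, with Euclidean norms and $\mathbf 1=(1,\dots,1)$ (and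 $\lambda(\alpha)=0$ if $N=1$). **Theorem 1 (Stability).** Given the hidden Markov model and $\kappa_K,\kappa_g>0$, there exist constants $D>0$ and $\rho\in(0,1)$ with the following property. Let $y$ be any sequence of observations for which the assumption holds with the constants $\kappa_K,\kappa_g$, let $N\ge1$, and let $\alpha\in\mathbb R^{N\times N}$ be any bi-stochastic matrix such that the uniform distribution on $\{1,\dots,N\}$ is the unique invariant distribution of $\alpha$ and $\lambda(\alpha)<1/\kappa_g^2$. Then, for every $t\ge0$, $$N\,|||\widehat\pi_t^N-\pi_t|||^2\le\frac{D}{1-\rho}\cdot\frac{\kappa_g^4\,(1-\lambda(\alpha)^2)}{1-\kappa_g^4\,\lambda(\alpha)^2}.$$ -/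

import Mathlib

open MeasureTheory ProbabilityTheory
open scoped ENNReal

/-- A hidden Markov model with state space `X` and observation space `Y`. The transition from time
`t - 1` to time `t` is `K t`, for `t ≥ 1` (the kernel `K 0` plays no role). The observation at time
`t`, given the hidden state `x`, has the strictly positive density `g t x` with respect to the
`σ`-finite measure `ref`. -/
structure HMM (X Y : Type*) [MeasurableSpace X] [MeasurableSpace Y] where
  init : Measure X
  isProb_init : IsProbabilityMeasure init
  K : ℕ → Kernel X X
  isMarkov_K : ∀ t, IsMarkovKernel (K t)
  ref : Measure Y
  sigmaFinite_ref : SigmaFinite ref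
  g : ℕ → X → Y → ℝ
  measurable_g : ∀ t, Measurable (Function.uncurry (g t))
  g_pos : ∀ t x y, 0 < g t x y
  lintegral_g : ∀ t x, ∫⁻ y, ENNReal.ofReal (g t x y) ∂ref = 1

attribute [instance] HMM.isProb_init HMM.isMarkov_K HMM.sigmaFinite_ref

noncomputable section

namespace HMM

variable {X Y : Type*} [MeasurableSpace X] [MeasurableSpace Y]

/-- The potential functions `x ↦ g_t(x, y_t)` attached to the observations `y`. -/
def potential (M : HMM X Y) (y : ℕ → Y) (t : ℕ) (x : X) : ℝ := M.g t x (y t)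

/-- The law of the hidden path `(X_0, …, X_T)`, that is
`π_0(dx_0) ∏_{t=1}^T K_t(x_{t-1}, dx_t)` on `X^{T+1}`. -/
def pathLaw (M : HMM X Y) : (T : ℕ) → Measure (Fin (T + 1) → X)
  | 0 => M.init.map (fun x _ => x)
  | T + 1 =>
    (M.pathLaw T ⊗ₘ
      (M.K (T + 1)).comap (fun x : Fin (T + 1) → X => x (Fin.last T)) (measurable_pi_apply _)).map
        (fun p => (Fin.snoc p.1 p.2 : Fin (T + 1 + 1) → X))

/-- The unnormalised measure
`γ_T(φ) = ∫ π_0(dx_0) ∏_{t=1}^T K_t(x_{t-1}, dx_t) ∏_{t=0}^{T-1} g_t(x_t) φ(x_T)`. -/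
def unnormalized (M : HMM X Y) (y : ℕ → Y) (T : ℕ) : Measure X :=
  ((M.pathLaw T).withDensity
    (fun x => ∏ t : Fin T, ENNReal.ofReal (M.potential y t (x t.castSucc)))).map
      (fun x => x (Fin.last T))

/-- The filtering distribution `π_T = γ_T / Z_T`, where `Z_T = γ_T(1)`. -/
def filtering (M : HMM X Y) (y : ℕ → Y) (T : ℕ) : Measure X :=
  (M.unnormalized y T Set.univ)⁻¹ • M.unnormalized y T

/-- The strong-mixing assumption: for `t ≥ 1` the kernel `K_t` has a density with respect to some
`σ`-finite measure, with values between `κK⁻¹` and `κK`, and for `t ≥ 0` the potential `g_t` has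
values between `κg⁻¹` and `κg`. -/
structure StrongMixing (M : HMM X Y) (y : ℕ → Y) (κK κg : ℝ) : Prop where
  kernel_bounds : ∀ t, 1 ≤ t → ∃ η : Measure X, SigmaFinite η ∧ ∃ k : X → X → ℝ,
    (∀ x, Measurable (k x)) ∧
    (∀ x, M.K t x = η.withDensity (fun x' => ENNReal.ofReal (k x x'))) ∧
    ∀ x x', κK⁻¹ ≤ k x x' ∧ k x x' ≤ κK
  potential_bounds : ∀ t x, κg⁻¹ ≤ M.potential y t x ∧ M.potential y t x ≤ κg

end HMM

namespace AlphaSMC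

variable {X Y Ω : Type*} [MeasurableSpace X] [MeasurableSpace Y] [MeasurableSpace Ω] {N : ℕ}

/-- The unnormalised weights `W_t^i`: `W_0^i = 1` and
`W_{t+1}^i = ∑_j α_t^{ij} W_t^j g_t(ξ_t^j)`, where `ξ_t^j` is the `j`-th particle at time `t`. -/
def weight (M : HMM X Y) (y : ℕ → Y) (α : ℕ → Matrix (Fin N) (Fin N) ℝ)
    (ξ : ℕ → Fin N → Ω → X) : ℕ → Fin N → Ω → ℝ
  | 0, _, _ => 1
  | t + 1, i, ω =>
    ∑ j, α t i j * weight M y α ξ t j ω * M.potential y t (ξ t j ω)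

/-- The normalised weights. -/
def normWeight (M : HMM X Y) (y : ℕ → Y) (α : ℕ → Matrix (Fin N) (Fin N) ℝ)
    (ξ : ℕ → Fin N → Ω → X) (t : ℕ) (i : Fin N) (ω : Ω) : ℝ :=
  weight M y α ξ t i ω / ∑ j, weight M y α ξ t j ω

/-- The particle approximation of the filtering distribution at time `t`. -/
def empirical (M : HMM X Y) (y : ℕ → Y) (α : ℕ → Matrix (Fin N) (Fin N) ℝ)
    (ξ : ℕ → Fin N → Ω → X) (t : ℕ) (ω : Ω) : Measure X :=
  ∑ i, ENNReal.ofReal (normWeight M y α ξ t i ω) • Measure.dirac (ξ t i ω)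

/-- The distribution from which the `i`-th particle at time `t + 1` is sampled, given the past:
`(1 / W_{t+1}^i) ∑_j α_t^{ij} W_t^j g_t(ξ_t^j) K_{t+1}(ξ_t^j, ·)`. -/
def mutation (M : HMM X Y) (y : ℕ → Y) (α : ℕ → Matrix (Fin N) (Fin N) ℝ)
    (ξ : ℕ → Fin N → Ω → X) (t : ℕ) (i : Fin N) (ω : Ω) : Measure X :=
  ∑ j, ENNReal.ofReal
      (α t i j * weight M y α ξ t j ω * M.potential y t (ξ t j ω) / weight M y α ξ (t + 1) i ω) •
    M.K (t + 1) (ξ t j ω)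

/-- The `σ`-algebra generated by all the particles up to and including time `t`. -/
abbrev history (ξ : ℕ → Fin N → Ω → X) (t : ℕ) : MeasurableSpace Ω :=
  ⨆ (s : ℕ) (_ : s ≤ t) (i : Fin N), MeasurableSpace.comap (ξ s i) inferInstance

/-- `ξ` is a realisation, on the probability space `(Ω, P)`, of the particles of the `α`-SMC
algorithm: the particles at time `0` are i.i.d. with law `π_0`, and conditionally on the past those
at time `t + 1` are independent, the `i`-th one with law `mutation … t i`. -/
structure IsParticleSystem (M : HMM X Y) (y : ℕ → Y) (α : ℕ → Matrix (Fin N) (Fin N) ℝ)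
    (P : Measure Ω) (ξ : ℕ → Fin N → Ω → X) : Prop where
  measurable : ∀ t i, Measurable (ξ t i)
  initial_law : P.map (fun ω i => ξ 0 i ω) = Measure.pi (fun _ : Fin N => M.init)
  conditional_law : ∀ (t : ℕ) (A : Fin N → Set X), (∀ i, MeasurableSet (A i)) →
    P⟦⋂ i, ξ (t + 1) i ⁻¹' A i | history ξ t⟧
      =ᵐ[P] fun ω => ∏ i, (mutation M y α ξ t i ω).real (A i)

end AlphaSMC

/-- The real-valued measurable functions bounded by one in absolute value. -/
def testFunctions (X : Type*) [MeasurableSpace X] : Set (X → ℝ) :=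
  {φ | Measurable φ ∧ ∀ x, |φ x| ≤ 1}

/-- The square `|||μ - ν|||²` of the triple norm of the difference of two random probability
measures, that is the supremum over the test functions `φ` of `E[(μ(φ) - ν(φ))²]`. -/
def tripleNormSq {X Ω : Type*} [MeasurableSpace X] [MeasurableSpace Ω] (P : Measure Ω)
    (μ ν : Ω → Measure X) : ℝ≥0∞ :=
  ⨆ φ ∈ testFunctions X, ∫⁻ ω, ENNReal.ofReal ((∫ x, φ x ∂(μ ω) - ∫ x, φ x ∂(ν ω)) ^ 2) ∂P

/-- The mixing constant `λ(α)`: the supremum of `‖α v‖` (Euclidean norm) over the unit vectors `v`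
that are orthogonal to `(1, …, 1)`; it is `0` if there are no such vectors (`N = 1`). -/
def mixingConstant {N : ℕ} (α : Matrix (Fin N) (Fin N) ℝ) : ℝ :=
  sSup {r | ∃ v : EuclideanSpace ℝ (Fin N), ‖v‖ = 1 ∧ inner ℝ v (WithLp.toLp 2 1) = 0 ∧
    r = ‖Matrix.toEuclideanLin α v‖}

/-- The uniform distribution is the unique invariant probability distribution of `α`. -/
def UniformIsUniqueInvariant {N : ℕ} (α : Matrix (Fin N) (Fin N) ℝ) : Prop :=
  ∀ p ∈ stdSimplex ℝ (Fin N), Matrix.vecMul p α = p ↔ p = fun _ => (1 : ℝ) / N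

end

/-! Write Q_{s,t} = g_s K_{s+1} ⋯ g_{t-1} K_t (`backward`). Because the columns of α sum to one, the
conditional mean of ∑ W_{s+1}^i f(X_{s+1}^i) given the past is ∑ W_s^i (g_s K_{s+1} f)(X_s^i). The
total error therefore telescopes into t + 1 local errors, each being the change in a ratio of the
type (Q_{s,t} f) / (Q_{s,t} 1) caused by sampling at a single time s
(`integral_empirical_sub_integral_filtering`).

A local error is small for two reasons. The first is mixing: Q_{s,t} f equals c · Q_{s,t} 1 up to a
relative error ρ^(t-s), and Q_{s,t} 1 has a bounded oscillation ratio, so the ratio hardly feels the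
perturbation (`exists_abs_backward_sub_le`, `div_sub_div_sq_le`). The second is averaging: given the
past the particles are independent, so with normalised weights a_i the variance is at most C² ∑
a_i², where ∑ a_i² is the inverse effective sample size.

That quantity is at most r / N with r = (1 - λ²) / (1 - κg⁴ λ²) (`sum_weight_sq_le`). Indeed α
contracts the weights around their mean by λ, the potentials inflate N ∑ W² / (∑ W)² by at most κg⁴,
and r is the fixed point of r ↦ 1 - λ² + λ² κg⁴ r, finite since λ κg² < 1.

Local mean square errors are thus of order ρ^(2(t-s)) r / N, and they sum to a bound uniform in t.
-/

/-- Bounded measurable real functions. -/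
def BoundedMeasurable {E : Type*} [MeasurableSpace E] (f : E → ℝ) : Prop :=
  Measurable f ∧ ∃ C, ∀ x, |f x| ≤ C

namespace BoundedMeasurable

variable {E F : Type*} [MeasurableSpace E] [MeasurableSpace F] {f g : E → ℝ}

theorem integrable (hf : BoundedMeasurable f) (μ : Measure E) [IsFiniteMeasure μ] :
    Integrable f μ := by
  obtain ⟨hm, C, hC⟩ := hf
  exact Integrable.of_bound hm.aestronglyMeasurable C (ae_of_all _ hC)

theorem const (c : ℝ) : BoundedMeasurable (fun _ : E => c) :=
  ⟨measurable_const, |c|, fun _ => le_rfl⟩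

theorem mul (hf : BoundedMeasurable f) (hg : BoundedMeasurable g) :
    BoundedMeasurable (fun x => f x * g x) := by
  obtain ⟨hm, C, hC⟩ := hf
  obtain ⟨hm', C', hC'⟩ := hg
  refine ⟨hm.mul hm', C * C', fun x => ?_⟩
  rw [abs_mul]
  exact mul_le_mul (hC x) (hC' x) (abs_nonneg _) ((abs_nonneg _).trans (hC x))

theorem sub (hf : BoundedMeasurable f) (hg : BoundedMeasurable g) :
    BoundedMeasurable (fun x => f x - g x) := by
  obtain ⟨hm, C, hC⟩ := hf
  obtain ⟨hm', C', hC'⟩ := hg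
  exact ⟨hm.sub hm', C + C', fun x => (abs_sub _ _).trans (add_le_add (hC x) (hC' x))⟩

theorem comp (hf : BoundedMeasurable f) {φ : F → E} (hφ : Measurable φ) :
    BoundedMeasurable (fun x => f (φ x)) :=
  ⟨hf.1.comp hφ, hf.2.imp fun _ h x => h (φ x)⟩

theorem integral_kernel (hf : BoundedMeasurable f) (κ : Kernel F E) [IsMarkovKernel κ] :
    BoundedMeasurable (fun x => ∫ z, f z ∂κ x) := by
  refine ⟨hf.1.stronglyMeasurable.integral_kernel.measurable, ?_⟩
  obtain ⟨C, hC⟩ := hf.2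
  refine ⟨C, fun x => ?_⟩
  have := norm_integral_le_of_norm_le_const (μ := κ x) (f := f) (C := C) (ae_of_all _ hC)
  simpa using this

theorem prod {ι : Type*} (s : Finset ι) {f : ι → E → ℝ} (hf : ∀ i, BoundedMeasurable (f i)) :
    BoundedMeasurable (fun x => ∏ i ∈ s, f i x) := by
  classical
  induction s using Finset.induction_on with
  | empty => simpa using const 1
  | insert a s ha ih =>
    simp only [Finset.prod_insert ha]
    exact (hf a).mul ih

end BoundedMeasurable

/-! ### Exponential forgetting of the backward operators. -/

namespace HMM

variable {X Y : Type*} [MeasurableSpace X] [MeasurableSpace Y]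

theorem measurable_potential (M : HMM X Y) (y : ℕ → Y) (t : ℕ) : Measurable (M.potential y t) :=
  (M.measurable_g t).comp (measurable_id.prodMk measurable_const)

theorem potential_pos (M : HMM X Y) (y : ℕ → Y) (t : ℕ) (x : X) : 0 < M.potential y t x :=
  M.g_pos t x (y t)

/-- The one-step operator `f ↦ g_s K_{s+1} f`. -/
noncomputable def step (M : HMM X Y) (y : ℕ → Y) (s : ℕ) (f : X → ℝ) (x : X) : ℝ :=
  M.potential y s x * ∫ z, f z ∂M.K (s + 1) x

/-- The iterated operator `f ↦ g_s K_{s+1} (g_{s+1} K_{s+2} (⋯ f))`, with `n` factors. -/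
noncomputable def backward (M : HMM X Y) (y : ℕ → Y) : ℕ → ℕ → (X → ℝ) → X → ℝ
  | 0, _, f => f
  | n + 1, s, f => M.step y s (M.backward y n (s + 1) f)

namespace StrongMixing

variable {M : HMM X Y} {y : ℕ → Y} {κK κg : ℝ}

theorem nonempty (M : HMM X Y) : Nonempty X := nonempty_of_isProbabilityMeasure M.init

theorem one_le_kg (h : M.StrongMixing y κK κg) (hκg : 0 < κg) : 1 ≤ κg := by
  obtain ⟨x⟩ := nonempty M
  have h1 := h.potential_bounds 0 x
  have h2 : κg⁻¹ ≤ κg := h1.1.trans h1.2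
  rw [inv_le_iff_one_le_mul₀ hκg] at h2
  nlinarith

theorem boundedMeasurable_potential (h : M.StrongMixing y κK κg) (t : ℕ) :
    BoundedMeasurable (M.potential y t) :=
  ⟨M.measurable_potential y t, κg, fun x => by
    rw [abs_of_pos (M.potential_pos y t x)]; exact (h.potential_bounds t x).2⟩

theorem boundedMeasurable_step (h : M.StrongMixing y κK κg) (s : ℕ) {f : X → ℝ}
    (hf : BoundedMeasurable f) : BoundedMeasurable (M.step y s f) :=
  (h.boundedMeasurable_potential s).mul (hf.integral_kernel _)

theorem boundedMeasurable_backward (h : M.StrongMixing y κK κg) (n : ℕ) :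
    ∀ (s : ℕ) {f : X → ℝ}, BoundedMeasurable f → BoundedMeasurable (M.backward y n s f) := by
  induction n with
  | zero => exact fun s f hf => hf
  | succ n ih => exact fun s f hf => h.boundedMeasurable_step s (ih (s + 1) hf)

/-- Both laws have densities against the same η, and an upper bound κK divided by a lower bound κK⁻¹
costs κK². -/
theorem kernel_le (h : M.StrongMixing y κK κg) (hκK : 0 < κK) (s : ℕ) (x x' : X) :
    M.K (s + 1) x ≤ ENNReal.ofReal (κK ^ 2) • M.K (s + 1) x' := by
  obtain ⟨η, _, k, hk, hK, hb⟩ := h.kernel_bounds (s + 1) (by omega)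
  rw [hK x, hK x', ← withDensity_smul _ (by have := hk x'; fun_prop)]
  refine withDensity_mono (ae_of_all _ fun z => ?_)
  simp only [Pi.smul_apply, smul_eq_mul]
  rw [← ENNReal.ofReal_mul (by positivity)]
  refine ENNReal.ofReal_le_ofReal ((hb x z).2.trans ?_)
  calc κK = κK ^ 2 * κK⁻¹ := by field_simp
    _ ≤ _ := mul_le_mul_of_nonneg_left (hb x' z).1 (by positivity)

theorem integral_kernel_le (h : M.StrongMixing y κK κg) (hκK : 0 < κK) (s : ℕ) (x x' : X)
    {f : X → ℝ} (hf : BoundedMeasurable f) (h0 : ∀ x, 0 ≤ f x) :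
    ∫ z, f z ∂M.K (s + 1) x ≤ κK ^ 2 * ∫ z, f z ∂M.K (s + 1) x' := by
  have := integral_mono_measure (h.kernel_le hκK s x x') (ae_of_all _ h0)
    ((hf.integrable (M.K (s + 1) x')).smul_measure ENNReal.ofReal_ne_top)
  rwa [integral_smul_measure, ENNReal.toReal_ofReal (by positivity), smul_eq_mul] at this

/-- The functions `g_s K_{s+1} (⋯ 1)` are positive, with a uniformly bounded ratio. -/
theorem exists_backward_one_bounds (h : M.StrongMixing y κK κg) (hκK : 0 < κK) (hκg : 0 < κg)
    (n : ℕ) : ∀ s, ∃ m, 0 < m ∧ ∀ x, m ≤ M.backward y n s (fun _ => 1) x ∧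
      M.backward y n s (fun _ => 1) x ≤ (1 + (κg * κK ^ 2) ^ 2) * m := by
  induction n with
  -- The summand 1 in the constant takes care of this case.
  | zero => exact fun s => ⟨1, one_pos, fun x => ⟨le_rfl, by simp [backward]; positivity⟩⟩
  | succ n ih =>
    intro s
    obtain ⟨m, hm, hb⟩ := ih (s + 1)
    obtain ⟨x₀⟩ := nonempty M
    set f := M.backward y n (s + 1) (fun _ => 1)
    have hf : BoundedMeasurable f := h.boundedMeasurable_backward n _ (.const 1)
    have hpos : ∀ x, 0 < ∫ z, f z ∂M.K (s + 1) x := fun x => by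
      have := integral_mono (μ := M.K (s + 1) x) (integrable_const m) (hf.integrable _)
        (fun z => (hb z).1)
      simp only [integral_const, probReal_univ, one_smul] at this
      linarith
    have h0 : ∀ x, 0 ≤ f x := fun x => hm.le.trans (hb x).1
    -- A single step already controls the ratio: moving from x₀ to x costs κK² in the kernel and κg
    -- in the potential, on either side. The constant does not grow with n because the induction
    -- hypothesis only supplies positivity.
    refine ⟨κg⁻¹ * ((κK ^ 2)⁻¹ * ∫ z, f z ∂M.K (s + 1) x₀),
      by have := hpos x₀; positivity, fun x => ?_⟩
    have hg := h.potential_bounds s x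
    have h1 := h.integral_kernel_le hκK s x x₀ hf h0
    have h2 := h.integral_kernel_le hκK s x₀ x hf h0
    have hx := hpos x
    have hx₀ := hpos x₀
    constructor
    · refine mul_le_mul hg.1 ?_ (by positivity) (M.potential_pos y s x).le
      rwa [inv_mul_le_iff₀ (by positivity)]
    · calc M.step y s f x ≤ κg * (κK ^ 2 * ∫ z, f z ∂M.K (s + 1) x₀) :=
            mul_le_mul hg.2 h1 hx.le hκg.le
        _ = (κg * κK ^ 2) ^ 2 * (κg⁻¹ * ((κK ^ 2)⁻¹ * ∫ z, f z ∂M.K (s + 1) x₀)) := by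
            field_simp
        _ ≤ _ := mul_le_mul_of_nonneg_right (by linarith) (by positivity)

/-- Doeblin contraction for the ratio of the two backward functions: if it ranges in [a, b], one
more step averages it with kernels that are mutually comparable, which shrinks the range by a fixed
factor. The potential multiplies numerator and denominator alike and has no effect. -/
theorem exists_backward_bracket (h : M.StrongMixing y κK κg) (hκK : 0 < κK) (hκg : 0 < κg)
    {f : X → ℝ} (hf : Measurable f) (hf1 : ∀ x, |f x| ≤ 1) (n : ℕ) :
    ∀ s, ∃ a b, b - a ≤ 2 * (1 - 1 / (2 * (1 + κK ^ 4))) ^ n ∧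
      ∀ x, a * M.backward y n s (fun _ => 1) x ≤ M.backward y n s f x ∧
        M.backward y n s f x ≤ b * M.backward y n s (fun _ => 1) x := by
  -- All that is needed is 0 < ε ≤ 1 and ε κK⁴ ≤ 1.
  set ε := 1 / (2 * (1 + κK ^ 4)) with hε
  have hε0 : 0 < ε := by positivity
  have hε1 : ε * (κK ^ 2 * κK ^ 2) ≤ 1 := by
    rw [hε, one_div, inv_mul_le_iff₀ (by positivity)]
    nlinarith [pow_pos hκK 4]
  have hε2 : ε ≤ 1 := by
    rw [hε, div_le_one (by positivity)]; nlinarith [pow_pos hκK 4]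
  induction n with
  | zero => exact fun s => ⟨-1, 1, by norm_num, fun x => by simpa [backward, abs_le] using hf1 x⟩
  | succ n ih =>
    intro s
    obtain ⟨a, b, hab, hB⟩ := ih (s + 1)
    obtain ⟨m, hm, hb⟩ := h.exists_backward_one_bounds hκK hκg n (s + 1)
    obtain ⟨x₀⟩ := nonempty M
    set p := M.backward y n (s + 1) (fun _ => 1) with hp_def
    set q := M.backward y n (s + 1) f with hq_def
    have hp : BoundedMeasurable p := h.boundedMeasurable_backward n _ (.const 1)
    have hq : BoundedMeasurable q := h.boundedMeasurable_backward n _ ⟨hf, 1, hf1⟩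
    have hpos : ∀ x, 0 < ∫ z, p z ∂M.K (s + 1) x := fun x => by
      have := integral_mono (μ := M.K (s + 1) x) (integrable_const m) (hp.integrable _)
        (fun z => (hb z).1)
      simp only [integral_const, probReal_univ, one_smul] at this
      linarith
    have hca : BoundedMeasurable (fun z => q z - a * p z) := hq.sub ((BoundedMeasurable.const a).mul hp)
    have hcb : BoundedMeasurable (fun z => b * p z - q z) := ((BoundedMeasurable.const b).mul hp).sub hq
    have ia : ∀ x, ∫ z, (q z - a * p z) ∂M.K (s + 1) x
        = ∫ z, q z ∂M.K (s + 1) x - a * ∫ z, p z ∂M.K (s + 1) x := fun x => by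
      rw [integral_sub (hq.integrable _) ((hp.integrable _).const_mul a), integral_const_mul]
    have ib : ∀ x, ∫ z, (b * p z - q z) ∂M.K (s + 1) x
        = b * ∫ z, p z ∂M.K (s + 1) x - ∫ z, q z ∂M.K (s + 1) x := fun x => by
      rw [integral_sub ((hp.integrable _).const_mul b) (hq.integrable _), integral_const_mul]
    set P : X → ℝ := fun x => ∫ z, p z ∂M.K (s + 1) x with hP
    set Q : X → ℝ := fun x => ∫ z, q z ∂M.K (s + 1) x with hQ
    have hP0 := hpos x₀
    set A := Q x₀ / P x₀ with hA
    have hQA : Q x₀ = A * P x₀ := by rw [hA]; exact (div_mul_cancel₀ _ hP0.ne').symm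
    -- Two comparisons at κK² each, absorbed by ε: one bounds P x by P x₀, the other bounds the
    -- nonnegative remainder at x₀ by its value u at x.
    have key : ∀ x u d, 0 ≤ d → d * P x₀ ≤ κK ^ 2 * u → ε * d * P x ≤ u := by
      intro x u d hd hu
      have h1 : P x ≤ κK ^ 2 * P x₀ :=
        h.integral_kernel_le hκK s x x₀ hp fun z => hm.le.trans (hb z).1
      have hu0 : 0 ≤ u := by
        have : 0 ≤ κK ^ 2 * u := (mul_nonneg hd hP0.le).trans hu
        exact nonneg_of_mul_nonneg_right this (by positivity)
      calc ε * d * P x ≤ ε * d * (κK ^ 2 * P x₀) := by gcongr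
        _ = ε * κK ^ 2 * (d * P x₀) := by ring
        _ ≤ ε * κK ^ 2 * (κK ^ 2 * u) := by gcongr
        _ = ε * (κK ^ 2 * κK ^ 2) * u := by ring
        _ ≤ 1 * u := by gcongr
        _ = u := one_mul u
    have haA : 0 ≤ A - a := by
      have : 0 ≤ ∫ z, (q z - a * p z) ∂M.K (s + 1) x₀ :=
        integral_nonneg fun z => by simpa using (hB z).1
      rw [ia] at this
      change 0 ≤ Q x₀ - a * P x₀ at this
      rw [hQA, ← sub_mul] at this
      exact nonneg_of_mul_nonneg_left this hP0
    have hAb : 0 ≤ b - A := by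
      have : 0 ≤ ∫ z, (b * p z - q z) ∂M.K (s + 1) x₀ :=
        integral_nonneg fun z => by simpa using (hB z).2
      rw [ib] at this
      change 0 ≤ b * P x₀ - Q x₀ at this
      rw [hQA, ← sub_mul] at this
      exact nonneg_of_mul_nonneg_left this hP0
    -- Both endpoints move towards the ratio A at x₀ by a proportion ε, so the length is multiplied
    -- by 1 - ε.
    refine ⟨a + ε * (A - a), b - ε * (b - A), ?_, fun x => ?_⟩
    · have : b - ε * (b - A) - (a + ε * (A - a)) = (1 - ε) * (b - a) := by ring
      rw [this, pow_succ]
      nlinarith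
    · have hg := M.potential_pos y s x
      have h1 : ε * (A - a) * P x ≤ Q x - a * P x := by
        refine key x _ _ haA ?_
        have := h.integral_kernel_le hκK s x₀ x hca fun z => by linarith [(hB z).1]
        rw [ia, ia] at this
        change Q x₀ - a * P x₀ ≤ κK ^ 2 * (Q x - a * P x) at this
        rwa [hQA, ← sub_mul] at this
      have h2 : ε * (b - A) * P x ≤ b * P x - Q x := by
        refine key x _ _ hAb ?_
        have := h.integral_kernel_le hκK s x₀ x hcb fun z => by linarith [(hB z).2]
        rw [ib, ib] at this
        change b * P x₀ - Q x₀ ≤ κK ^ 2 * (b * P x - Q x) at this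
        rwa [hQA, ← sub_mul] at this
      change _ * (M.potential y s x * P x) ≤ M.potential y s x * Q x ∧
        M.potential y s x * Q x ≤ _ * (M.potential y s x * P x)
      constructor
      · rw [mul_left_comm]
        exact mul_le_mul_of_nonneg_left (by linarith) hg.le
      · rw [mul_left_comm]
        exact mul_le_mul_of_nonneg_left (by linarith) hg.le

/-- Exponential forgetting: up to a geometrically small relative error, `g_s K_{s+1} (⋯ f)` is
proportional to `g_s K_{s+1} (⋯ 1)`. -/
theorem exists_abs_backward_sub_le (h : M.StrongMixing y κK κg) (hκK : 0 < κK) (hκg : 0 < κg)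
    {f : X → ℝ} (hf : Measurable f) (hf1 : ∀ x, |f x| ≤ 1) (n s : ℕ) :
    ∃ c, ∀ x, |M.backward y n s f x - c * M.backward y n s (fun _ => 1) x| ≤
      (1 - 1 / (2 * (1 + κK ^ 4))) ^ n * M.backward y n s (fun _ => 1) x := by
  obtain ⟨a, b, hab, hB⟩ := h.exists_backward_bracket hκK hκg hf hf1 n s
  obtain ⟨m, hm, hb⟩ := h.exists_backward_one_bounds hκK hκg n s
  -- The midpoint halves the length 2 ρ^n of the bracket.
  refine ⟨(a + b) / 2, fun x => ?_⟩
  have h0 : 0 < M.backward y n s (fun _ => 1) x := hm.trans_le (hb x).1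
  have := mul_le_mul_of_nonneg_right hab h0.le
  rw [abs_le]
  constructor <;> nlinarith [hB x]

end StrongMixing

/-! ### The filtering distributions through the backward operators. -/

theorem measurable_snoc (T : ℕ) :
    Measurable (fun p : (Fin (T + 1) → X) × X => (Fin.snoc p.1 p.2 : Fin (T + 1 + 1) → X)) := by
  refine measurable_pi_iff.2 fun i => ?_
  induction i using Fin.lastCases with
  | last => simpa using measurable_snd
  | cast i => simpa [Function.comp_def] using (measurable_pi_apply i).comp measurable_fst

instance isProbabilityMeasure_pathLaw (M : HMM X Y) (T : ℕ) :
    IsProbabilityMeasure (M.pathLaw T) := by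
  induction T with
  | zero => exact Measure.isProbabilityMeasure_map (by fun_prop)
  | succ T ih => exact Measure.isProbabilityMeasure_map (measurable_snoc T).aemeasurable

theorem integral_unnormalized (M : HMM X Y) (y : ℕ → Y)
    (T : ℕ) {f : X → ℝ} (hf : BoundedMeasurable f) :
    ∫ x, f x ∂M.unnormalized y T =
      ∫ x, (∏ t : Fin T, M.potential y t (x t.castSucc)) * f (x (Fin.last T)) ∂M.pathLaw T := by
  have hp := M.measurable_potential y
  rw [unnormalized, integral_map (measurable_pi_apply _).aemeasurable hf.1.aestronglyMeasurable,
    integral_withDensity_eq_integral_toReal_smul]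
  · refine integral_congr_ae (ae_of_all _ fun x => ?_)
    simp only [smul_eq_mul, ENNReal.toReal_prod]
    congr 1
    exact Finset.prod_congr rfl fun t _ => ENNReal.toReal_ofReal (M.potential_pos y _ _).le
  · exact Finset.measurable_fun_prod _ fun t _ =>
      ((hp t).comp (measurable_pi_apply _)).ennreal_ofReal
  · exact ae_of_all _ fun x => ENNReal.prod_lt_top fun t _ => ENNReal.ofReal_lt_top

namespace StrongMixing

variable {M : HMM X Y} {y : ℕ → Y} {κK κg : ℝ}

/-- Integrating out the last coordinate of the path turns f into K_{T+1} f, and the last potential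
in the product completes it to g_T K_{T+1} f. -/
theorem integral_unnormalized_succ (h : M.StrongMixing y κK κg)
    (T : ℕ) {f : X → ℝ} (hf : BoundedMeasurable f) :
    ∫ x, f x ∂M.unnormalized y (T + 1) = ∫ x, M.step y T f x ∂M.unnormalized y T := by
  have hbp := h.boundedMeasurable_potential
  have hb : ∀ S, BoundedMeasurable fun x : Fin (S + 1) → X =>
      ∏ t : Fin S, M.potential y t (x t.castSucc) := fun S =>
    BoundedMeasurable.prod _ fun t => (hbp t).comp (measurable_pi_apply _)
  have hb' : ∀ S, BoundedMeasurable fun x : Fin (S + 1) → X =>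
      (∏ t : Fin S, M.potential y t (x t.castSucc)) * f (x (Fin.last S)) := fun S =>
    (hb S).mul (hf.comp (measurable_pi_apply _))
  rw [M.integral_unnormalized y _ hf,
    M.integral_unnormalized y _ (h.boundedMeasurable_step T hf)]
  rw [pathLaw, integral_map (measurable_snoc T).aemeasurable (hb' (T + 1)).1.aestronglyMeasurable,
    Measure.integral_compProd (((hb' (T + 1)).comp (measurable_snoc T)).integrable _)]
  refine integral_congr_ae (ae_of_all _ fun x => ?_)
  simp only [Fin.snoc_castSucc, Fin.snoc_last, integral_const_mul, Kernel.comap_apply]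
  rw [Fin.prod_univ_castSucc, mul_assoc]
  rfl

theorem integral_unnormalized_add (h : M.StrongMixing y κK κg) (n : ℕ) :
    ∀ (s : ℕ) {f : X → ℝ}, BoundedMeasurable f →
    ∫ x, f x ∂M.unnormalized y (s + n) = ∫ x, M.backward y n s f x ∂M.unnormalized y s := by
  induction n with
  | zero => exact fun s f hf => rfl
  | succ n ih =>
    intro s f hf
    rw [← Nat.succ_add_eq_add_succ, ih (s + 1) hf,
      h.integral_unnormalized_succ s (h.boundedMeasurable_backward n _ hf)]
    rfl

theorem integral_filtering (h : M.StrongMixing y κK κg) (t : ℕ) {f : X → ℝ}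
    (hf : BoundedMeasurable f) :
    ∫ x, f x ∂M.filtering y t =
      (∫ x, M.backward y t 0 f x ∂M.init) / ∫ x, M.backward y t 0 (fun _ => 1) x ∂M.init := by
  have h0 : ∀ {f : X → ℝ}, BoundedMeasurable f →
      ∫ x, f x ∂M.unnormalized y t = ∫ x, M.backward y t 0 f x ∂M.init := fun {f} hf => by
    have := h.integral_unnormalized_add t 0 hf
    rw [zero_add] at this
    rw [this, M.integral_unnormalized y _ (h.boundedMeasurable_backward t 0 hf), pathLaw,
      integral_map (by fun_prop)]
    · simp
    · have := (h.boundedMeasurable_backward t 0 hf).1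
      simp only [Finset.univ_eq_empty, Finset.prod_empty, one_mul]
      exact (this.comp (measurable_pi_apply _)).aestronglyMeasurable
  rw [filtering, integral_smul_measure, h0 hf, ← h0 (.const 1), integral_const, div_eq_inv_mul]
  simp [Measure.real, ENNReal.toReal_inv]

end StrongMixing

end HMM

/-! ### Conditional independence and variance of weighted sums. -/

/-- A random element whose conditional law given `H` is `κ (H ω)`, on a `π`-system that generates
the `σ`-algebra, has joint law `P.map H ⊗ₘ κ` with `H`. -/
theorem map_prodMk_eq_compProd_of_condExp {Ω Z E : Type*} [MeasurableSpace Ω] [mZ : MeasurableSpace Z]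
    [mE : MeasurableSpace E] (P : Measure Ω) [IsProbabilityMeasure P] {H : Ω → Z}
    (hH : Measurable H) {V : Ω → E} (hV : Measurable V) (κ : Kernel Z E) [IsMarkovKernel κ]
    (C : Set (Set E)) (hgen : mE = MeasurableSpace.generateFrom C) (hpi : IsPiSystem C)
    (huniv : Set.univ ∈ C)
    (h : ∀ A ∈ C, P⟦V ⁻¹' A | mZ.comap H⟧ =ᵐ[P] fun ω => (κ (H ω)).real A) :
    P.map (fun ω => (H ω, V ω)) = P.map H ⊗ₘ κ := by
  have hHV : Measurable fun ω => (H ω, V ω) := hH.prodMk hV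
  have := Measure.isProbabilityMeasure_map (μ := P) hH.aemeasurable
  have := Measure.isProbabilityMeasure_map (μ := P) hHV.aemeasurable
  -- Rectangles B × A with A in `C` form a generating π-system; on them the two measures agree by
  -- integrating the conditional probability of A over H⁻¹ B.
  refine ext_of_generate_finite (Set.image2 (· ×ˢ ·) {s : Set Z | MeasurableSet s} C)
    (generateFrom_eq_prod MeasurableSpace.generateFrom_measurableSet hgen.symm
      isCountablySpanning_measurableSet ⟨fun _ => Set.univ, fun _ => huniv, Set.iUnion_const _⟩).symm
    (MeasurableSpace.isPiSystem_measurableSet.prod hpi) ?_ (by simp)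
  rintro _ ⟨B, hB, A, hA, rfl⟩
  have hB : MeasurableSet B := hB
  have hAm : MeasurableSet A := by
    rw [hgen]; exact MeasurableSpace.measurableSet_generateFrom hA
  rw [Measure.map_apply hHV (hB.prod hAm), Measure.compProd_apply_prod hB hAm,
    setLIntegral_map hB (κ.measurable_coe hAm) hH]
  have hle : mZ.comap H ≤ ‹MeasurableSpace Ω› := hH.comap_le
  have hint : Integrable ((V ⁻¹' A).indicator fun _ : Ω => (1 : ℝ)) P :=
    (integrable_const 1).indicator (hV hAm)
  have key := setIntegral_condExp hle hint (s := H ⁻¹' B) ⟨B, hB, rfl⟩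
  rw [setIntegral_congr_ae (hH hB) ((h A hA).mono fun ω hω _ => hω),
    integral_indicator (hV hAm), setIntegral_const, smul_eq_mul, mul_one,
    measureReal_restrict_apply (hV hAm)] at key
  have e : (H ⁻¹' B ∩ V ⁻¹' A) = (fun ω => (H ω, V ω)) ⁻¹' (B ×ˢ A) := rfl
  have hm : Measurable fun ω => (κ (H ω)) A := (κ.measurable_coe hAm).comp hH
  simp only [Measure.real] at key
  rw [integral_toReal hm.aemeasurable (ae_of_all _ fun ω => measure_lt_top _ _)] at key
  rw [← e, Set.inter_comm]
  refine ((ENNReal.toReal_eq_toReal_iff' ?_ (measure_ne_top _ _)).1 key).symm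
  refine ((setLIntegral_mono_ae aemeasurable_const (ae_of_all _ fun ω _ => prob_le_one)).trans_lt
    ?_).ne
  simp

/-- The kernel of product measures attached to finitely many Markov kernels. -/
noncomputable def ProbabilityTheory.Kernel.piOf {Z E ι : Type*} [MeasurableSpace Z]
    [MeasurableSpace E] [Fintype ι]
    (κ : ι → Kernel Z E) [∀ i, IsMarkovKernel (κ i)] : Kernel Z (ι → E) where
  toFun z := Measure.pi fun i => κ i z
  measurable' := by
    refine Measurable.measure_of_isPiSystem_of_isProbabilityMeasure generateFrom_pi.symm
      isPiSystem_pi ?_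
    rintro _ ⟨A, hA, rfl⟩
    simp only [Measure.pi_pi]
    exact Finset.measurable_fun_prod _ fun i _ => (κ i).measurable_coe (hA i (Set.mem_univ i))

instance {Z E ι : Type*} [MeasurableSpace Z] [MeasurableSpace E] [Fintype ι]
    (κ : ι → Kernel Z E) [∀ i, IsMarkovKernel (κ i)] : IsMarkovKernel (Kernel.piOf κ) :=
  ⟨fun z => inferInstanceAs (IsProbabilityMeasure (Measure.pi fun i => κ i z))⟩

/-- The mean square fluctuation of a weighted sum of independent bounded variables. -/
theorem lintegral_pi_weighted_sum_sub_sq_le {E ι : Type*} [MeasurableSpace E] [Fintype ι]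
    (μ : ι → Measure E) [∀ i, IsProbabilityMeasure (μ i)] (a : ι → ℝ) {f : E → ℝ}
    (hf : Measurable f) {C : ℝ} (hC : ∀ x, |f x| ≤ C) :
    ∫⁻ v, ENNReal.ofReal ((∑ i, a i * f (v i) - ∑ i, a i * ∫ x, f x ∂μ i) ^ 2) ∂Measure.pi μ ≤
      ENNReal.ofReal (C ^ 2 * ∑ i, a i ^ 2) := by
  have hb : BoundedMeasurable f := ⟨hf, C, hC⟩
  have hmem : ∀ i, MemLp (fun x => a i * f x) 2 (μ i) := fun i =>
    (MemLp.of_bound hf.aestronglyMeasurable C (ae_of_all _ hC)).const_mul (a i)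
  -- Independence makes the variance additive; each term is then bounded by its second moment, at
  -- most C² a_i².
  have hvar := variance_sum_pi hmem
  have hmem' : MemLp (∑ i, fun v : ι → E => a i * f (v i)) 2 (Measure.pi μ) :=
    memLp_finsetSum' _ fun i _ => (hmem i).comp_measurePreserving (measurePreserving_eval _ i)
  have hmean : ∫ v, (∑ i, fun v : ι → E => a i * f (v i)) v ∂Measure.pi μ
      = ∑ i, a i * ∫ x, f x ∂μ i := by
    simp only [Finset.sum_apply]
    rw [integral_finsetSum _ fun i _ => ?_]
    · refine Finset.sum_congr rfl fun i _ => ?_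
      rw [integral_const_mul, ← (measurePreserving_eval μ i).map_eq,
        integral_map (measurable_pi_apply i).aemeasurable hf.aestronglyMeasurable]
    · exact ((hb.comp (measurable_pi_apply i)).integrable _).const_mul _
  rw [variance_eq_integral hmem'.aestronglyMeasurable.aemeasurable, hmean] at hvar
  simp only [Finset.sum_apply] at hvar
  rw [← ofReal_integral_eq_lintegral_ofReal, hvar]
  · refine ENNReal.ofReal_le_ofReal ?_
    rw [Finset.mul_sum]
    refine Finset.sum_le_sum fun i _ => ?_
    refine (variance_le_expectation_sq (hmem i).aestronglyMeasurable).trans ?_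
    have hsq : ∀ x, f x ^ 2 ≤ C ^ 2 := fun x => sq_le_sq' (abs_le.1 (hC x)).1 (abs_le.1 (hC x)).2
    have := integral_mono (μ := μ i) (f := fun x => (a i * f x) ^ 2)
      (g := fun _ => C ^ 2 * a i ^ 2) (hmem i).integrable_sq (integrable_const _) fun x => by
        have := mul_le_mul_of_nonneg_left (hsq x) (sq_nonneg (a i))
        nlinarith
    simpa using this
  · have := (hmem'.sub (memLp_const (∑ i, a i * ∫ x, f x ∂μ i))).integrable_sq
    simpa using this
  · exact ae_of_all _ fun v => sq_nonneg _

/-- The mean square fluctuation of a weighted sum of conditionally independent bounded variables,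
with weights known from the conditioning. -/
theorem lintegral_cond_weighted_sum_sub_sq_le {Ω Z E ι : Type*} [MeasurableSpace Ω]
    [mZ : MeasurableSpace Z] [MeasurableSpace E] [Fintype ι] (P : Measure Ω)
    [IsProbabilityMeasure P] {H : Ω → Z} (hH : Measurable H) {V : ι → Ω → E}
    (hV : ∀ i, Measurable (V i)) (κ : ι → Kernel Z E) [∀ i, IsMarkovKernel (κ i)]
    (h : ∀ A : ι → Set E, (∀ i, MeasurableSet (A i)) →
      P⟦⋂ i, V i ⁻¹' A i | mZ.comap H⟧ =ᵐ[P] fun ω => ∏ i, (κ i (H ω)).real (A i))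
    {a : ι → Z → ℝ} (ha : ∀ i, Measurable (a i)) {B : ℝ} (hB : ∀ z, ∑ i, a i z ^ 2 ≤ B)
    {f : E → ℝ} (hf : Measurable f) {C : ℝ} (hC : ∀ x, |f x| ≤ C) :
    ∫⁻ ω, ENNReal.ofReal ((∑ i, a i (H ω) * f (V i ω)
      - ∑ i, a i (H ω) * ∫ x, f x ∂κ i (H ω)) ^ 2) ∂P ≤ ENNReal.ofReal (C ^ 2 * B) := by
  have hVm : Measurable fun ω i => V i ω := measurable_pi_iff.2 hV
  -- Once the joint law is disintegrated, the conditioning variable can be frozen: the weights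
  -- become constants and the particles have a product law.
  have hlaw := map_prodMk_eq_compProd_of_condExp P hH hVm (Kernel.piOf κ)
    (Set.pi Set.univ '' Set.pi Set.univ fun _ : ι => {s : Set E | MeasurableSet s})
    generateFrom_pi.symm isPiSystem_pi
    ⟨fun _ => Set.univ, fun _ _ => MeasurableSet.univ, Set.pi_univ _⟩ (by
      rintro _ ⟨A, hA, rfl⟩
      have e : (fun ω i => V i ω) ⁻¹' Set.pi Set.univ A = ⋂ i, V i ⁻¹' A i := by
        ext; simp
      rw [e]
      refine (h A fun i => hA i (Set.mem_univ i)).trans (ae_of_all _ fun ω => ?_)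
      change _ = (Measure.pi fun i => κ i (H ω)).real _
      simp [Measure.real, Measure.pi_pi, ENNReal.toReal_prod])
  set G : Z × (ι → E) → ℝ≥0∞ := fun p => ENNReal.ofReal ((∑ i, a i p.1 * f (p.2 i)
      - ∑ i, a i p.1 * ∫ x, f x ∂κ i p.1) ^ 2) with hG
  have hGm : Measurable G := by
    have h1 : ∀ i, Measurable fun z => ∫ x, f x ∂κ i z := fun i =>
      hf.stronglyMeasurable.integral_kernel.measurable
    refine Measurable.ennreal_ofReal (Measurable.pow_const (Measurable.sub ?_ ?_) 2)
    · exact Finset.measurable_fun_sum _ fun i _ => ((ha i).comp measurable_fst).mul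
        (hf.comp ((measurable_pi_apply i).comp measurable_snd))
    · exact Finset.measurable_fun_sum _ fun i _ => ((ha i).comp measurable_fst).mul
        ((h1 i).comp measurable_fst)
  have := Measure.isProbabilityMeasure_map (μ := P) hH.aemeasurable
  calc ∫⁻ ω, G (H ω, fun i => V i ω) ∂P
      = ∫⁻ p, G p ∂P.map (fun ω => (H ω, fun i => V i ω)) :=
        (lintegral_map hGm (hH.prodMk hVm)).symm
    _ = ∫⁻ z, ∫⁻ v, G (z, v) ∂(Measure.pi fun i => κ i z) ∂P.map H := by
        rw [hlaw, Measure.lintegral_compProd hGm]; rfl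
    _ ≤ ∫⁻ _, ENNReal.ofReal (C ^ 2 * B) ∂P.map H := by
        refine lintegral_mono fun z =>
          (lintegral_pi_weighted_sum_sub_sq_le (fun i => κ i z) (fun i => a i z) hf hC).trans ?_
        exact ENNReal.ofReal_le_ofReal (mul_le_mul_of_nonneg_left (hB z) (sq_nonneg C))
    _ = _ := by simp

/-! ### Contraction of bi-stochastic matrices. -/

section Matrix

variable {N : ℕ} {α : Matrix (Fin N) (Fin N) ℝ}

theorem mixingConstant_nonneg (α : Matrix (Fin N) (Fin N) ℝ) : 0 ≤ mixingConstant α :=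
  Real.sSup_nonneg fun _ ⟨_, _, _, h⟩ => h ▸ norm_nonneg _

theorem norm_toEuclideanLin_le (α : Matrix (Fin N) (Fin N) ℝ) {v : EuclideanSpace ℝ (Fin N)}
    (hv : inner ℝ v (WithLp.toLp 2 1) = 0) :
    ‖Matrix.toEuclideanLin α v‖ ≤ mixingConstant α * ‖v‖ := by
  by_cases h0 : v = 0
  · simp [h0]
  have hn : 0 < ‖v‖ := norm_pos_iff.2 h0
  have hle : ‖Matrix.toEuclideanLin α (‖v‖⁻¹ • v)‖ ≤ mixingConstant α := by
    -- The operator norm bounds the set, so that its real supremum is a genuine one.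
    refine le_csSup ⟨‖(Matrix.toEuclideanLin α).toContinuousLinearMap‖, ?_⟩
      ⟨‖v‖⁻¹ • v, ?_, ?_, rfl⟩
    · rintro _ ⟨u, hu, -, rfl⟩
      simpa [hu] using (Matrix.toEuclideanLin α).toContinuousLinearMap.le_opNorm u
    · rw [norm_smul, norm_inv, norm_norm, inv_mul_cancel₀ hn.ne']
    · rw [inner_smul_left, hv, mul_zero]
  rw [map_smul, norm_smul, norm_inv, norm_norm, inv_mul_le_iff₀ hn] at hle
  linarith

theorem sum_mulVec_sq_le_of_sum_eq_zero (α : Matrix (Fin N) (Fin N) ℝ) {u : Fin N → ℝ}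
    (hu : ∑ i, u i = 0) :
    ∑ i, (α.mulVec u) i ^ 2 ≤ mixingConstant α ^ 2 * ∑ i, u i ^ 2 := by
  have h := norm_toEuclideanLin_le α (v := WithLp.toLp 2 u) (by
    simpa [PiLp.inner_apply] using hu)
  have h2 := pow_le_pow_left₀ (norm_nonneg _) h 2
  rw [mul_pow, EuclideanSpace.norm_sq_eq, EuclideanSpace.norm_sq_eq] at h2
  simpa [Matrix.toEuclideanLin] using h2

theorem sum_mulVec (hα : α ∈ doublyStochastic ℝ (Fin N)) (v : Fin N → ℝ) :
    ∑ i, (α.mulVec v) i = ∑ i, v i := by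
  simp only [Matrix.mulVec, dotProduct]
  rw [Finset.sum_comm]
  simp [← Finset.sum_mul, sum_col_of_mem_doublyStochastic hα]

/-- The contraction of a bi-stochastic matrix around the mean. -/
theorem sum_mulVec_sq_le (hN : 1 ≤ N) (hα : α ∈ doublyStochastic ℝ (Fin N)) (v : Fin N → ℝ) :
    N * ∑ i, (α.mulVec v) i ^ 2 ≤ (1 - mixingConstant α ^ 2) * (∑ i, v i) ^ 2
      + mixingConstant α ^ 2 * (N * ∑ i, v i ^ 2) := by
  have hN0 : (N : ℝ) ≠ 0 := by positivity
  -- Split v into its mean and a sum-zero part u. The matrix fixes constants (rows) and preserves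
  -- sum zero (columns), so Pythagoras applies before and after, and λ acts on u alone.
  set m := (∑ i, v i) / N with hm
  have hS : ∑ i, v i = N * m := by rw [hm]; field_simp
  set u : Fin N → ℝ := fun i => v i - m with hu
  have hu0 : ∑ i, u i = 0 := by simp [hu, hS]
  have hα1 : α.mulVec (fun _ => m) = fun _ => m := by
    ext i
    simp [Matrix.mulVec, dotProduct, ← Finset.sum_mul, sum_row_of_mem_doublyStochastic hα]
  have hv : α.mulVec v = fun i => α.mulVec u i + m := by
    have : v = u + fun _ => m := by ext; simp [hu]
    conv_lhs => rw [this, Matrix.mulVec_add, hα1]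
    rfl
  have e : ∀ w : Fin N → ℝ, ∑ i, w i = 0 → ∑ i, (w i + m) ^ 2 = ∑ i, w i ^ 2 + N * m ^ 2 := by
    intro w hw
    have : ∀ i, (w i + m) ^ 2 = w i ^ 2 + 2 * m * w i + m ^ 2 := fun i => by ring
    simp only [this, Finset.sum_add_distrib, ← Finset.mul_sum, hw]
    simp
  have e1 := e (α.mulVec u) (by rw [sum_mulVec hα, hu0])
  have e2 : ∑ i, v i ^ 2 = ∑ i, u i ^ 2 + N * m ^ 2 := by
    rw [← e u hu0]; simp [hu]
  have h := mul_le_mul_of_nonneg_left (sum_mulVec_sq_le_of_sum_eq_zero α hu0)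
    (Nat.cast_nonneg (α := ℝ) N)
  rw [hv, e1, e2, hS]
  nlinarith

end Matrix

/-! ### Weights, effective sample size and one-step sampling error. -/

namespace AlphaSMC

variable {X Y Ω : Type*} [MeasurableSpace X] [MeasurableSpace Y] {N : ℕ}
  {M : HMM X Y} {y : ℕ → Y} {α : Matrix (Fin N) (Fin N) ℝ} {ξ : ℕ → Fin N → Ω → X}

/-- A row of α sums to one, so it cannot vanish, and every other factor is positive. -/
theorem weight_pos (M : HMM X Y) (y : ℕ → Y) (hα : α ∈ doublyStochastic ℝ (Fin N))
    (ξ : ℕ → Fin N → Ω → X) (t : ℕ) (i : Fin N) (ω : Ω) :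
    0 < weight M y (fun _ => α) ξ t i ω := by
  induction t generalizing i with
  | zero => exact one_pos
  | succ t ih =>
    have h0 : ∀ j, 0 ≤ α i j * weight M y (fun _ => α) ξ t j ω * M.potential y t (ξ t j ω) :=
      fun j => mul_nonneg (mul_nonneg (nonneg_of_mem_doublyStochastic hα) (ih j).le)
        (M.potential_pos y t _).le
    refine lt_of_le_of_ne (Finset.sum_nonneg fun j _ => h0 j) fun h => ?_
    have hz := (Finset.sum_eq_zero_iff_of_nonneg fun j _ => h0 j).1 h.symm
    have hrow := sum_row_of_mem_doublyStochastic hα i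
    rw [Finset.sum_eq_zero fun j hj => ?_] at hrow
    · exact zero_ne_one hrow
    · have := hz j hj
      rw [mul_assoc, mul_eq_zero] at this
      exact this.resolve_right (mul_pos (ih j) (M.potential_pos y t _)).ne'

theorem weight_succ_eq_mulVec (t : ℕ) (ω : Ω) :
    (fun i => weight M y (fun _ => α) ξ (t + 1) i ω) =
      α.mulVec fun j => weight M y (fun _ => α) ξ t j ω * M.potential y t (ξ t j ω) := by
  ext i
  simp [weight, Matrix.mulVec, dotProduct, mul_assoc]

/-- The lower bound on the effective sample size. -/
theorem sum_weight_sq_le {κK κg : ℝ} (h : M.StrongMixing y κK κg) (hκg : 0 < κg) (hN : 1 ≤ N)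
    (hα : α ∈ doublyStochastic ℝ (Fin N)) (hl : mixingConstant α < 1 / κg ^ 2) (t : ℕ) (ω : Ω) :
    N * ∑ i, weight M y (fun _ => α) ξ t i ω ^ 2 ≤
      (1 - mixingConstant α ^ 2) / (1 - κg ^ 4 * mixingConstant α ^ 2) *
        (∑ i, weight M y (fun _ => α) ξ t i ω) ^ 2 := by
  have hg1 := h.one_le_kg hκg
  have hl0 := mixingConstant_nonneg α
  set l := mixingConstant α
  have hlg : l * κg ^ 2 < 1 := by rwa [lt_div_iff₀ (by positivity)] at hl
  have hden : 0 < 1 - κg ^ 4 * l ^ 2 := by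
    have : κg ^ 4 * l ^ 2 = (l * κg ^ 2) ^ 2 := by ring
    rw [this]
    have : 0 ≤ l * κg ^ 2 := by positivity
    nlinarith
  have hl1 : 0 ≤ 1 - l ^ 2 := by
    have : l ≤ l * κg ^ 2 := le_mul_of_one_le_right hl0 (one_le_pow₀ hg1)
    nlinarith
  set r := (1 - l ^ 2) / (1 - κg ^ 4 * l ^ 2) with hr
  have hr0 : 0 ≤ r := div_nonneg hl1 hden.le
  -- As a fixed point of the recursion for the second moment, r makes the induction close exactly.
  have hfix : (1 - l ^ 2) + l ^ 2 * κg ^ 4 * r = r := by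
    have : r * (1 - κg ^ 4 * l ^ 2) = 1 - l ^ 2 := div_mul_cancel₀ _ hden.ne'
    linear_combination -this
  induction t with
  | zero =>
    have hr1 : 1 ≤ r := by
      rw [hr, one_le_div hden]
      have : 1 ≤ κg ^ 4 := one_le_pow₀ hg1
      nlinarith [sq_nonneg l]
    simp only [weight, one_pow, Finset.sum_const, Finset.card_univ, Fintype.card_fin, nsmul_eq_mul,
      mul_one]
    nlinarith [sq_nonneg (N : ℝ)]
  | succ t ih =>
    set w : Fin N → ℝ := fun j => weight M y (fun _ => α) ξ t j ω with hw
    have hw0 : ∀ j, 0 < w j := fun j => weight_pos M y hα ξ t j ω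
    set v : Fin N → ℝ := fun j => w j * M.potential y t (ξ t j ω) with hv
    have e : (fun i => weight M y (fun _ => α) ξ (t + 1) i ω) = α.mulVec v :=
      weight_succ_eq_mulVec t ω
    have e' : ∀ i, weight M y (fun _ => α) ξ (t + 1) i ω = α.mulVec v i := congrFun e
    simp only [e']
    rw [sum_mulVec hα]
    have hv1 : ∑ i, v i ^ 2 ≤ κg ^ 2 * ∑ i, w i ^ 2 := by
      rw [Finset.mul_sum]
      refine Finset.sum_le_sum fun i _ => ?_
      have := pow_le_pow_left₀ (M.potential_pos y t _).le (h.potential_bounds t (ξ t i ω)).2 2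
      rw [hv, mul_pow, mul_comm]
      exact mul_le_mul_of_nonneg_right this (sq_nonneg _)
    have hv2 : ∑ i, w i ≤ κg * ∑ i, v i := by
      rw [Finset.mul_sum]
      refine Finset.sum_le_sum fun i _ => ?_
      have := (h.potential_bounds t (ξ t i ω)).1
      rw [inv_le_iff_one_le_mul₀ hκg] at this
      calc w i = w i * 1 := (mul_one _).symm
        _ ≤ w i * (M.potential y t (ξ t i ω) * κg) := mul_le_mul_of_nonneg_left this (hw0 i).le
        _ = _ := by simp only [hv]; ring
    have hv3 : (∑ i, w i) ^ 2 ≤ κg ^ 2 * (∑ i, v i) ^ 2 := by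
      rw [← mul_pow]
      exact pow_le_pow_left₀ (Finset.sum_nonneg fun i _ => (hw0 i).le) hv2 2
    -- The potentials cost κg² in the sum of squares and κg² in the square of the sum, whence κg⁴.
    calc N * ∑ i, α.mulVec v i ^ 2 ≤ _ := sum_mulVec_sq_le hN hα v
      _ ≤ (1 - l ^ 2) * (∑ i, v i) ^ 2 + l ^ 2 * (κg ^ 2 * (r * (κg ^ 2 * (∑ i, v i) ^ 2))) := by
          refine add_le_add_right (mul_le_mul_of_nonneg_left ?_ (sq_nonneg l)) _
          calc N * ∑ i, v i ^ 2 ≤ N * (κg ^ 2 * ∑ i, w i ^ 2) :=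
                mul_le_mul_of_nonneg_left hv1 (Nat.cast_nonneg N)
            _ = κg ^ 2 * (N * ∑ i, w i ^ 2) := by ring
            _ ≤ κg ^ 2 * (r * (∑ i, w i) ^ 2) := mul_le_mul_of_nonneg_left ih (sq_nonneg κg)
            _ ≤ _ := mul_le_mul_of_nonneg_left (mul_le_mul_of_nonneg_left hv3 hr0) (sq_nonneg κg)
      _ = ((1 - l ^ 2) + l ^ 2 * κg ^ 4 * r) * (∑ i, v i) ^ 2 := by ring
      _ = _ := by rw [hfix]

theorem measurable_weight {m : MeasurableSpace Ω} (t : ℕ)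
    (hξ : ∀ s < t, ∀ i, Measurable[m] (ξ s i)) (i : Fin N) :
    Measurable[m] fun ω => weight M y (fun _ => α) ξ t i ω := by
  induction t generalizing i with
  | zero => exact measurable_const
  | succ t ih =>
    refine Finset.measurable_fun_sum _ fun j _ => ?_
    exact (measurable_const.mul (ih (fun s hs => hξ s (by omega)) j)).mul
      ((M.measurable_potential y t).comp (hξ t (by omega) j))

theorem measurable_mutation {m : MeasurableSpace Ω} (t : ℕ)
    (hξ : ∀ s < t + 1, ∀ i, Measurable[m] (ξ s i)) (i : Fin N) :
    Measurable[m] fun ω => mutation M y (fun _ => α) ξ t i ω := by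
  refine Measure.measurable_of_measurable_coe _ fun A hA => ?_
  simp only [mutation, Measure.coe_finsetSum, Finset.sum_apply, Measure.smul_apply, smul_eq_mul]
  refine Finset.measurable_fun_sum _ fun j _ => Measurable.mul ?_ ?_
  · refine Measurable.ennreal_ofReal (Measurable.div ?_ (measurable_weight _ hξ i))
    exact (measurable_const.mul (measurable_weight t (fun s hs => hξ s (by omega)) j)).mul
      ((M.measurable_potential y t).comp (hξ t (by omega) j))
  · exact ((M.K (t + 1)).measurable_coe hA).comp (hξ t (by omega) j)

/-- Multiplying by the weight W_{t+1}^i cancels the normalisation of the sampling law, leaving an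
expression linear in f and in α. -/
theorem integral_mutation (hα : α ∈ doublyStochastic ℝ (Fin N)) (t : ℕ) (i : Fin N) (ω : Ω)
    {f : X → ℝ} (hf : BoundedMeasurable f) :
    weight M y (fun _ => α) ξ (t + 1) i ω * ∫ x, f x ∂mutation M y (fun _ => α) ξ t i ω =
      ∑ j, α i j * (weight M y (fun _ => α) ξ t j ω * M.step y t f (ξ t j ω)) := by
  rw [mutation, integral_finsetSum_measure fun j _ =>
    (hf.integrable _).smul_measure ENNReal.ofReal_ne_top, Finset.mul_sum]
  refine Finset.sum_congr rfl fun j _ => ?_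
  have hw := weight_pos M y hα ξ (t + 1) i ω
  have hw' := weight_pos M y hα ξ t j ω
  have hg := M.potential_pos y t (ξ t j ω)
  have ha := nonneg_of_mem_doublyStochastic hα (i := i) (j := j)
  rw [integral_smul_measure, ENNReal.toReal_ofReal (by positivity), smul_eq_mul, HMM.step]
  field_simp

theorem isProbabilityMeasure_mutation (hα : α ∈ doublyStochastic ℝ (Fin N)) (t : ℕ) (i : Fin N)
    (ω : Ω) : IsProbabilityMeasure (mutation M y (fun _ => α) ξ t i ω) := by
  refine ⟨?_⟩
  have hw := weight_pos M y hα ξ (t + 1) i ω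
  simp only [mutation, Measure.coe_finsetSum, Finset.sum_apply, Measure.smul_apply, smul_eq_mul,
    measure_univ, mul_one]
  rw [← ENNReal.ofReal_sum_of_nonneg, ← Finset.sum_div]
  · change ENNReal.ofReal (weight M y (fun _ => α) ξ (t + 1) i ω / _) = 1
    rw [div_self hw.ne', ENNReal.ofReal_one]
  · intro j _
    have hw' := weight_pos M y hα ξ t j ω
    have hg := M.potential_pos y t (ξ t j ω)
    have ha := nonneg_of_mem_doublyStochastic hα (i := i) (j := j)
    positivity

/-- The unnormalised particle approximation `∑ W_t^i f(X_t^i)`. -/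
noncomputable def weightedSum (M : HMM X Y) (y : ℕ → Y) (α : Matrix (Fin N) (Fin N) ℝ)
    (ξ : ℕ → Fin N → Ω → X) (t : ℕ) (f : X → ℝ) (ω : Ω) : ℝ :=
  ∑ i, weight M y (fun _ => α) ξ t i ω * f (ξ t i ω)

/-- The conditional mean of `weightedSum` given the past. -/
noncomputable def predictedSum (M : HMM X Y) (y : ℕ → Y) (α : Matrix (Fin N) (Fin N) ℝ)
    (ξ : ℕ → Fin N → Ω → X) : ℕ → (X → ℝ) → Ω → ℝ
  | 0, f, _ => N * ∫ x, f x ∂M.init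
  | t + 1, f, ω => weightedSum M y α ξ t (M.step y t f) ω

/-- The mean square sampling error of one step of the algorithm. -/
theorem lintegral_sampling_error_le [MeasurableSpace Ω] {κK κg : ℝ}
    (h : M.StrongMixing y κK κg) (hκg : 0 < κg)
    (hN : 1 ≤ N) (hα : α ∈ doublyStochastic ℝ (Fin N)) (hl : mixingConstant α < 1 / κg ^ 2)
    {P : Measure Ω} [IsProbabilityMeasure P] (hξ : IsParticleSystem M y (fun _ => α) P ξ)
    (t : ℕ) {f : X → ℝ} (hf : Measurable f) {C : ℝ} (hC : ∀ x, |f x| ≤ C) :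
    ∫⁻ ω, ENNReal.ofReal (((weightedSum M y α ξ t f ω - predictedSum M y α ξ t f ω) /
        ∑ i, weight M y (fun _ => α) ξ t i ω) ^ 2) ∂P ≤
      ENNReal.ofReal (C ^ 2 *
        ((1 - mixingConstant α ^ 2) / (1 - κg ^ 4 * mixingConstant α ^ 2) / N)) := by
  have : Nonempty (Fin N) := ⟨⟨0, hN⟩⟩
  have hN0 : (0 : ℝ) < N := by positivity
  have hSpos : ∀ ω, 0 < ∑ i, weight M y (fun _ => α) ξ t i ω := fun ω =>
    Finset.sum_pos (fun i _ => weight_pos M y hα ξ t i ω) Finset.univ_nonempty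
  set r := (1 - mixingConstant α ^ 2) / (1 - κg ^ 4 * mixingConstant α ^ 2)
  set a : Fin N → Ω → ℝ := fun i ω =>
    weight M y (fun _ => α) ξ t i ω / ∑ i, weight M y (fun _ => α) ξ t i ω with ha
  -- The sum of squared normalised weights is the inverse effective sample size, and it is bounded
  -- for every ω, not only on average.
  have hB : ∀ ω, ∑ i, a i ω ^ 2 ≤ r / N := fun ω => by
    have := sum_weight_sq_le (ξ := ξ) h hκg hN hα hl t ω
    simp only [ha, div_pow, ← Finset.sum_div]
    rw [div_le_div_iff₀ (pow_pos (hSpos ω) 2) hN0]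
    linarith
  have hbm : BoundedMeasurable f := ⟨hf, C, hC⟩
  cases t with
  | zero =>
    have hmeas : Measurable fun ω i => ξ 0 i ω := measurable_pi_iff.2 (hξ.measurable 0)
    have key := lintegral_pi_weighted_sum_sub_sq_le (fun _ : Fin N => M.init)
      (fun _ => 1 / (N : ℝ)) hf hC
    rw [← hξ.initial_law, lintegral_map (by fun_prop) hmeas] at key
    refine le_of_eq_of_le (lintegral_congr fun ω => ?_) (key.trans (ENNReal.ofReal_le_ofReal ?_))
    · congr 2
      simp only [weightedSum, predictedSum, weight, Finset.sum_const, Finset.card_univ,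
        Fintype.card_fin, nsmul_eq_mul, mul_one, one_mul, ← Finset.mul_sum]
      field_simp
    -- At time 0 the weights are deterministic, so any sample point gives the bound 1 / N ≤ r / N.
    · have h1 := hB (Classical.choice (nonempty_of_isProbabilityMeasure P))
      simp only [ha, weight] at h1
      refine mul_le_mul_of_nonneg_left (le_trans (le_of_eq ?_) h1) (sq_nonneg C)
      simp
  | succ t =>
    have hhist : ∀ s < t + 1, ∀ i, Measurable[history ξ t] (ξ s i) := fun s hs i =>
      (comap_measurable (ξ s i)).mono
        ((le_iSup (fun i => MeasurableSpace.comap (ξ s i) inferInstance) i).trans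
          (le_iSup₂_of_le (f := fun s (_ : s ≤ t) => ⨆ i, MeasurableSpace.comap (ξ s i) inferInstance)
            s (by omega) le_rfl)) le_rfl
    have hle : history ξ t ≤ ‹MeasurableSpace Ω› :=
      iSup₂_le fun s _ => iSup_le fun i => (hξ.measurable s i).comap_le
    -- The conditioning variable is the identity from Ω to Ω with the history σ-algebra. The weights
    -- at time t + 1 involve only particles up to time t, so sampling laws and weights are
    -- measurable for it.
    let κ : Fin N → @Kernel Ω X (history ξ t) _ := fun i =>
      @Kernel.mk Ω X (history ξ t) _ (fun ω => mutation M y (fun _ => α) ξ t i ω)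
        (measurable_mutation t hhist i)
    have hκ : ∀ i, @IsMarkovKernel Ω X (history ξ t) _ (κ i) := fun i =>
      @IsMarkovKernel.mk Ω X (history ξ t) _ (κ i) fun ω => isProbabilityMeasure_mutation hα t i ω
    have ham : ∀ i, Measurable[history ξ t] (a i) := fun i =>
      (measurable_weight (t + 1) hhist i).div
        (Finset.measurable_fun_sum _ fun i _ => measurable_weight (t + 1) hhist i)
    have key := lintegral_cond_weighted_sum_sub_sq_le (mZ := history ξ t) P (H := id)
      (measurable_id'' hle) (hξ.measurable (t + 1)) κ
      (fun A hA => by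
        rw [MeasurableSpace.comap_id]
        exact hξ.conditional_law t A hA) ham hB hf hC
    refine le_of_eq_of_le (lintegral_congr fun ω => ?_) key
    congr 2
    -- Summing over i first uses the unit column sums, after which α disappears from the conditional
    -- mean.
    have e : ∑ i, a i ω * ∫ x, f x ∂mutation M y (fun _ => α) ξ t i ω =
        weightedSum M y α ξ t (M.step y t f) ω / ∑ i, weight M y (fun _ => α) ξ (t + 1) i ω := by
      simp only [ha, div_mul_eq_mul_div, ← Finset.sum_div, integral_mutation hα t _ ω hbm]
      rw [Finset.sum_comm]
      simp only [← Finset.sum_mul, sum_col_of_mem_doublyStochastic hα, one_mul]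
      rfl
    change _ = ∑ i, a i ω * f (ξ (t + 1) i ω)
      - ∑ i, a i ω * ∫ x, f x ∂mutation M y (fun _ => α) ξ t i ω
    rw [e, sub_div]
    simp only [ha, div_mul_eq_mul_div, ← Finset.sum_div]
    rfl

end AlphaSMC

/-! ### Two elementary inequalities. -/

/-- Square integrability of a sum with geometrically decaying terms, by the Cauchy–Schwarz
inequality with geometric weights. -/
theorem lintegral_sum_geometric_sq_le {Ω : Type*} [MeasurableSpace Ω] (P : Measure Ω)
    {ρ B : ℝ} (hρ : 0 < ρ) (hρ1 : ρ < 1) (hB : 0 ≤ B) (t : ℕ) {T : ℕ → Ω → ℝ}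
    (hT : ∀ s, Measurable (T s))
    (h : ∀ s ≤ t, ∫⁻ ω, ENNReal.ofReal (T s ω ^ 2) ∂P ≤ ENNReal.ofReal ((ρ ^ (t - s)) ^ 2 * B)) :
    ∫⁻ ω, ENNReal.ofReal ((∑ s ∈ Finset.range (t + 1), T s ω) ^ 2) ∂P ≤
      ENNReal.ofReal (((1 - ρ)⁻¹) ^ 2 * B) := by
  have hρ' : 0 < 1 - ρ := by linarith
  have hgeom : ∑ s ∈ Finset.range (t + 1), ρ ^ (t - s) ≤ (1 - ρ)⁻¹ := by
    have := Finset.sum_range_reflect (fun i => ρ ^ i) (t + 1)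
    simp only [Nat.add_sub_cancel] at this
    rw [this]
    rw [← one_div, le_div_iff₀ hρ', mul_comm, mul_neg_geom_sum]
    linarith [pow_pos hρ (t + 1)]
  -- The weights ρ^(t-s) cost one factor (1 - ρ)⁻¹. Their inverses use up one of the two powers
  -- ρ^(t-s) in the hypothesis, and the other one gives the second factor (1 - ρ)⁻¹.
  have hcs : ∀ ω, (∑ s ∈ Finset.range (t + 1), T s ω) ^ 2 ≤
      ∑ s ∈ Finset.range (t + 1), ((1 - ρ)⁻¹ * (ρ ^ (t - s))⁻¹) * T s ω ^ 2 := fun ω => by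
    refine (Finset.sum_sq_le_sum_mul_sum_of_sq_le_mul _ (f := fun s => ρ ^ (t - s))
      (g := fun s => (ρ ^ (t - s))⁻¹ * T s ω ^ 2) (fun s _ => by positivity)
      (fun s _ => by positivity) fun s _ => ?_).trans ?_
    · exact le_of_eq (by field_simp)
    · simp only [mul_assoc, ← Finset.mul_sum]
      exact mul_le_mul_of_nonneg_right hgeom (Finset.sum_nonneg fun s _ => by positivity)
  calc ∫⁻ ω, ENNReal.ofReal ((∑ s ∈ Finset.range (t + 1), T s ω) ^ 2) ∂P
      ≤ ∫⁻ ω, ∑ s ∈ Finset.range (t + 1),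
          ENNReal.ofReal ((1 - ρ)⁻¹ * (ρ ^ (t - s))⁻¹) * ENNReal.ofReal (T s ω ^ 2) ∂P := by
        refine lintegral_mono fun ω => (ENNReal.ofReal_le_ofReal (hcs ω)).trans (le_of_eq ?_)
        rw [ENNReal.ofReal_sum_of_nonneg fun s _ => by positivity]
        exact Finset.sum_congr rfl fun s _ => ENNReal.ofReal_mul (by positivity)
    _ = ∑ s ∈ Finset.range (t + 1), ENNReal.ofReal ((1 - ρ)⁻¹ * (ρ ^ (t - s))⁻¹) *
          ∫⁻ ω, ENNReal.ofReal (T s ω ^ 2) ∂P := by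
        have hm : ∀ s, Measurable fun ω => ENNReal.ofReal (T s ω ^ 2) := fun s =>
          ((hT s).pow_const 2).ennreal_ofReal
        rw [lintegral_finsetSum _ fun s _ => (hm s).const_mul _]
        exact Finset.sum_congr rfl fun s _ => lintegral_const_mul _ (hm s)
    _ ≤ ∑ s ∈ Finset.range (t + 1), ENNReal.ofReal ((1 - ρ)⁻¹ * B * ρ ^ (t - s)) := by
        refine Finset.sum_le_sum fun s hs => ?_
        refine (mul_le_mul_right (h s (Nat.lt_succ_iff.1 (Finset.mem_range.1 hs))) _).trans
          (le_of_eq ?_)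
        rw [← ENNReal.ofReal_mul (by positivity)]
        congr 1
        field_simp
    _ = ENNReal.ofReal ((1 - ρ)⁻¹ * B * ∑ s ∈ Finset.range (t + 1), ρ ^ (t - s)) := by
        rw [Finset.mul_sum, ENNReal.ofReal_sum_of_nonneg fun s _ => by positivity]
    _ ≤ _ := by
        refine ENNReal.ofReal_le_ofReal ?_
        calc _ ≤ (1 - ρ)⁻¹ * B * (1 - ρ)⁻¹ := mul_le_mul_of_nonneg_left hgeom (by positivity)
          _ = _ := by ring

/-- The perturbation of a ratio, in terms of the perturbations of a combination of the numerator
and the denominator, and of the denominator. -/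
theorem div_sub_div_sq_le {S S' L L' c r w : ℝ} (hw : 0 < w) (hS' : w ≤ S')
    (hL' : 0 < L') (hL : |L - c * L'| ≤ r * L') :
    (S / S' - L / L') ^ 2 ≤
      2 * (((S - c * S' - (L - c * L')) / w) ^ 2 + r ^ 2 * ((S' - L') / w) ^ 2) := by
  have hS0 : 0 < S' := hw.trans_le hS'
  set u := S - c * S' - (L - c * L') with hu
  set k := (L - c * L') / L' with hk
  have hk1 : k ^ 2 ≤ r ^ 2 := by
    rw [← sq_abs, hk, abs_div, abs_of_pos hL']
    exact pow_le_pow_left₀ (by positivity) ((div_le_iff₀ hL').2 hL) 2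
  -- Subtracting c from both ratios does not change their difference, so only S - c S' and L - c L'
  -- matter.
  have e : S / S' - L / L' = (u - k * (S' - L')) / S' := by
    rw [hu, hk]; field_simp; ring
  rw [e, div_pow, div_pow, div_pow, div_le_iff₀ (by positivity)]
  have hw2 : w ^ 2 ≤ S' ^ 2 := pow_le_pow_left₀ hw.le hS' 2
  have h1 : (u - k * (S' - L')) ^ 2 ≤ 2 * (u ^ 2 + r ^ 2 * (S' - L') ^ 2) := by
    have := mul_le_mul_of_nonneg_right hk1 (sq_nonneg (S' - L'))
    nlinarith [sq_nonneg (u + k * (S' - L'))]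
  have e2 : 2 * (u ^ 2 / w ^ 2 + r ^ 2 * ((S' - L') ^ 2 / w ^ 2)) * S' ^ 2
      = 2 * (u ^ 2 + r ^ 2 * (S' - L') ^ 2) * (S' ^ 2 / w ^ 2) := by ring
  rw [e2]
  refine h1.trans (le_mul_of_one_le_right (by positivity) ?_)
  rwa [one_le_div (by positivity)]

/-! ### Propagation and telescoping of the sampling errors. -/

namespace AlphaSMC

variable {X Y Ω : Type*} [MeasurableSpace X] [MeasurableSpace Y] {N : ℕ}
  {M : HMM X Y} {y : ℕ → Y} {α : Matrix (Fin N) (Fin N) ℝ} {ξ : ℕ → Fin N → Ω → X} {κK κg : ℝ}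

theorem weightedSum_sub_mul (t : ℕ) (f g : X → ℝ) (c : ℝ) (ω : Ω) :
    weightedSum M y α ξ t (fun x => f x - c * g x) ω =
      weightedSum M y α ξ t f ω - c * weightedSum M y α ξ t g ω := by
  simp only [weightedSum, Finset.mul_sum, ← Finset.sum_sub_distrib]
  exact Finset.sum_congr rfl fun i _ => by ring

theorem predictedSum_sub_mul (t : ℕ) {f g : X → ℝ} (hf : BoundedMeasurable f)
    (hg : BoundedMeasurable g) (c : ℝ) (ω : Ω) :
    predictedSum M y α ξ t (fun x => f x - c * g x) ω =
      predictedSum M y α ξ t f ω - c * predictedSum M y α ξ t g ω := by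
  cases t with
  | zero =>
    simp only [predictedSum]
    rw [integral_sub (hf.integrable _) ((hg.integrable _).const_mul c), integral_const_mul]
    ring
  | succ t =>
    simp only [predictedSum]
    rw [← weightedSum_sub_mul]
    congr 1
    ext x
    simp only [HMM.step]
    rw [integral_sub (hf.integrable _) ((hg.integrable _).const_mul c), integral_const_mul]
    ring

theorem weightedSum_mono (hα : α ∈ doublyStochastic ℝ (Fin N)) (t : ℕ) {f g : X → ℝ}
    (hfg : ∀ x, f x ≤ g x) (ω : Ω) : weightedSum M y α ξ t f ω ≤ weightedSum M y α ξ t g ω :=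
  Finset.sum_le_sum fun i _ =>
    mul_le_mul_of_nonneg_left (hfg _) (weight_pos M y hα ξ t i ω).le

theorem predictedSum_nonneg (hα : α ∈ doublyStochastic ℝ (Fin N)) (t : ℕ) {f : X → ℝ}
    (hf : ∀ x, 0 ≤ f x) (ω : Ω) : 0 ≤ predictedSum M y α ξ t f ω := by
  cases t with
  | zero => exact mul_nonneg (Nat.cast_nonneg N) (integral_nonneg hf)
  | succ t =>
    rw [predictedSum, weightedSum]
    exact Finset.sum_nonneg fun i _ => mul_nonneg (weight_pos M y hα ξ t i ω).le
      (mul_nonneg (M.potential_pos y t _).le (integral_nonneg hf))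

/-- Linearity and positivity, applied to f + c g and c g - f. -/
theorem abs_predictedSum_le (hα : α ∈ doublyStochastic ℝ (Fin N)) (t : ℕ) {f g : X → ℝ}
    (hf : BoundedMeasurable f) (hg : BoundedMeasurable g) {c : ℝ} (hfg : ∀ x, |f x| ≤ c * g x)
    (ω : Ω) : |predictedSum M y α ξ t f ω| ≤ c * predictedSum M y α ξ t g ω := by
  have h1 := predictedSum_nonneg (M := M) (y := y) (ξ := ξ) hα t
    (f := fun x => f x - -c * g x) (fun x => by linarith [(abs_le.1 (hfg x)).1]) ω
  have h2 := predictedSum_nonneg (M := M) (y := y) (ξ := ξ) hα t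
    (f := fun x => c * g x - 1 * f x) (fun x => by linarith [(abs_le.1 (hfg x)).2]) ω
  have h3 := predictedSum_sub_mul (M := M) (y := y) (α := α) (ξ := ξ) t (.const 0) hg (-c) ω
  have h4 := predictedSum_sub_mul (M := M) (y := y) (α := α) (ξ := ξ) t (.const 0) hg c ω
  have h5 := predictedSum_sub_mul (M := M) (y := y) (α := α) (ξ := ξ) t
    ((BoundedMeasurable.const c).mul hg) hf 1 ω
  rw [predictedSum_sub_mul t hf hg] at h1
  have h6 : predictedSum M y α ξ t (fun x => c * g x) ω = c * predictedSum M y α ξ t g ω := by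
    have h0 : predictedSum M y α ξ t (fun _ => (0 : ℝ)) ω = 0 := by
      cases t <;> simp [predictedSum, weightedSum, HMM.step]
    rw [h0] at h3
    simpa using h3
  rw [h5, h6] at h2
  rw [abs_le]
  constructor <;> linarith

theorem measurable_weightedSum [MeasurableSpace Ω] (hξ : ∀ t i, Measurable (ξ t i)) (t : ℕ)
    {f : X → ℝ} (hf : Measurable f) : Measurable (weightedSum M y α ξ t f) :=
  Finset.measurable_fun_sum _ fun i _ =>
    (measurable_weight t (fun s _ => hξ s) i).mul (hf.comp (hξ t i))

theorem measurable_predictedSum [MeasurableSpace Ω] (hξ : ∀ t i, Measurable (ξ t i)) (t : ℕ)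
    {f : X → ℝ} (hf : Measurable f) : Measurable (predictedSum M y α ξ t f) := by
  cases t with
  | zero => exact measurable_const
  | succ t =>
    exact measurable_weightedSum hξ t ((M.measurable_potential y t).mul
      hf.stronglyMeasurable.integral_kernel.measurable)

theorem sum_weight_pos (M : HMM X Y) (y : ℕ → Y) (hN : 1 ≤ N)
    (hα : α ∈ doublyStochastic ℝ (Fin N)) (ξ : ℕ → Fin N → Ω → X) (t : ℕ) (ω : Ω) :
    0 < ∑ i, weight M y (fun _ => α) ξ t i ω :=
  have : Nonempty (Fin N) := ⟨⟨0, hN⟩⟩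
  Finset.sum_pos (fun i _ => weight_pos M y hα ξ t i ω) Finset.univ_nonempty

/-- After time 0 the predicted sum is a weighted sum one step earlier, with one more backward step;
hence the lower bound for n + 1 steps. -/
theorem predictedSum_backward_one_pos (h : M.StrongMixing y κK κg) (hκK : 0 < κK) (hκg : 0 < κg)
    (hN : 1 ≤ N) (hα : α ∈ doublyStochastic ℝ (Fin N)) (n t : ℕ) (ω : Ω) :
    0 < predictedSum M y α ξ t (M.backward y n t fun _ => 1) ω := by
  have hbm : BoundedMeasurable (M.backward y n t fun _ => 1) :=
    h.boundedMeasurable_backward n t (.const 1)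
  cases t with
  | zero =>
    obtain ⟨m, hm, hb⟩ := h.exists_backward_one_bounds hκK hκg n 0
    have := integral_mono (integrable_const m) (hbm.integrable M.init) fun x => (hb x).1
    simp only [integral_const, probReal_univ, one_smul] at this
    exact mul_pos (by positivity) (hm.trans_le this)
  | succ t =>
    obtain ⟨m, hm, hb⟩ := h.exists_backward_one_bounds hκK hκg (n + 1) t
    refine lt_of_lt_of_le ?_ (weightedSum_mono hα t (fun x => (hb x).1) ω)
    rw [weightedSum, ← Finset.sum_mul]
    exact mul_pos (sum_weight_pos M y hN hα ξ t ω) hm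

/-- The mean square error that one sampling step contributes to the final estimate. -/
theorem lintegral_propagated_error_le [MeasurableSpace Ω] (h : M.StrongMixing y κK κg)
    (hκK : 0 < κK) (hκg : 0 < κg) (hN : 1 ≤ N) (hα : α ∈ doublyStochastic ℝ (Fin N))
    (hl : mixingConstant α < 1 / κg ^ 2) {P : Measure Ω} [IsProbabilityMeasure P]
    (hξ : IsParticleSystem M y (fun _ => α) P ξ) (n t : ℕ) {f : X → ℝ} (hf : Measurable f)
    (hf1 : ∀ x, |f x| ≤ 1) :
    ∫⁻ ω, ENNReal.ofReal
      ((weightedSum M y α ξ t (M.backward y n t f) ω /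
          weightedSum M y α ξ t (M.backward y n t fun _ => 1) ω -
        predictedSum M y α ξ t (M.backward y n t f) ω /
          predictedSum M y α ξ t (M.backward y n t fun _ => 1) ω) ^ 2) ∂P ≤
      ENNReal.ofReal (((1 - 1 / (2 * (1 + κK ^ 4))) ^ n) ^ 2 *
        (4 * (1 + (κg * κK ^ 2) ^ 2) ^ 2 *
          ((1 - mixingConstant α ^ 2) / (1 - κg ^ 4 * mixingConstant α ^ 2) / N))) := by
  obtain ⟨m, hm, hb⟩ := h.exists_backward_one_bounds hκK hκg n t
  obtain ⟨c, hc⟩ := h.exists_abs_backward_sub_le hκK hκg hf hf1 n t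
  have hρ : 0 ≤ 1 - 1 / (2 * (1 + κK ^ 4)) := by
    rw [sub_nonneg, div_le_one (by positivity)]
    nlinarith [pow_pos hκK 4]
  set r := (1 - 1 / (2 * (1 + κK ^ 4))) ^ n
  have hr : 0 ≤ r := pow_nonneg hρ n
  set C := 1 + (κg * κK ^ 2) ^ 2
  set R := (1 - mixingConstant α ^ 2) / (1 - κg ^ 4 * mixingConstant α ^ 2) / N
  set q := M.backward y n t f
  set p := M.backward y n t fun _ => 1
  have hq : BoundedMeasurable q := h.boundedMeasurable_backward n t ⟨hf, 1, hf1⟩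
  have hp : BoundedMeasurable p := h.boundedMeasurable_backward n t (.const 1)
  have hu : BoundedMeasurable fun x => q x - c * p x := hq.sub ((BoundedMeasurable.const c).mul hp)
  set err : (X → ℝ) → Ω → ℝ := fun f ω =>
    (weightedSum M y α ξ t f ω - predictedSum M y α ξ t f ω) /
      ∑ i, weight M y (fun _ => α) ξ t i ω with herr
  have herrm : ∀ {f : X → ℝ}, Measurable f → Measurable (err f) := fun hf =>
    ((measurable_weightedSum hξ.measurable t hf).sub
      (measurable_predictedSum hξ.measurable t hf)).div
      (Finset.measurable_fun_sum _ fun i _ => measurable_weight t (fun s _ => hξ.measurable s) i)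
  -- The two test functions have sup norms r C m and C m. In the ratio the second error carries the
  -- factor r, so both contribute r² C² m² R; the factor 2 / m² then gives 4 C² r² R, free of m.
  have h1 := lintegral_sampling_error_le h hκg hN hα hl hξ t hu.1 (C := r * (C * m)) fun x =>
    (hc x).trans (mul_le_mul_of_nonneg_left (hb x).2 hr)
  have h2 := lintegral_sampling_error_le h hκg hN hα hl hξ t hp.1 (C := C * m) fun x => by
    rw [abs_of_pos (hm.trans_le (hb x).1)]; exact (hb x).2
  have hpt : ∀ ω, (weightedSum M y α ξ t q ω / weightedSum M y α ξ t p ω -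
      predictedSum M y α ξ t q ω / predictedSum M y α ξ t p ω) ^ 2 ≤
      2 / m ^ 2 * (err (fun x => q x - c * p x) ω ^ 2 + r ^ 2 * err p ω ^ 2) := fun ω => by
    have hw := sum_weight_pos M y hN hα ξ t ω
    have hS : (∑ i, weight M y (fun _ => α) ξ t i ω) * m ≤ weightedSum M y α ξ t p ω := by
      rw [Finset.sum_mul]
      exact weightedSum_mono hα t (fun x => (hb x).1) ω
    have hL := abs_predictedSum_le (M := M) (y := y) (ξ := ξ) hα t hu hp hc ω
    rw [predictedSum_sub_mul t hq hp] at hL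
    refine (div_sub_div_sq_le (c := c) (mul_pos hw hm) hS
      (predictedSum_backward_one_pos h hκK hκg hN hα n t ω) hL).trans (le_of_eq ?_)
    simp only [herr]
    rw [weightedSum_sub_mul, predictedSum_sub_mul t hq hp]
    field_simp
    rfl
  calc _ ≤ ∫⁻ ω, ENNReal.ofReal (2 / m ^ 2) * (ENNReal.ofReal (err (fun x => q x - c * p x) ω ^ 2)
          + ENNReal.ofReal (r ^ 2) * ENNReal.ofReal (err p ω ^ 2)) ∂P := by
        refine lintegral_mono fun ω => (ENNReal.ofReal_le_ofReal (hpt ω)).trans (le_of_eq ?_)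
        rw [ENNReal.ofReal_mul (by positivity), ENNReal.ofReal_add (by positivity) (by positivity),
          ENNReal.ofReal_mul (by positivity)]
    _ = ENNReal.ofReal (2 / m ^ 2) * (∫⁻ ω, ENNReal.ofReal (err (fun x => q x - c * p x) ω ^ 2) ∂P
          + ENNReal.ofReal (r ^ 2) * ∫⁻ ω, ENNReal.ofReal (err p ω ^ 2) ∂P) := by
        have m1 := ((herrm hu.1).pow_const 2).ennreal_ofReal
        have m2 := ((herrm hp.1).pow_const 2).ennreal_ofReal
        have m3 : Measurable fun ω => ENNReal.ofReal (err (fun x => q x - c * p x) ω ^ 2) +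
            ENNReal.ofReal (r ^ 2) * ENNReal.ofReal (err p ω ^ 2) := m1.add (m2.const_mul _)
        rw [lintegral_const_mul _ m3, lintegral_add_left m1, lintegral_const_mul _ m2]
    _ ≤ ENNReal.ofReal (2 / m ^ 2) * (ENNReal.ofReal ((r * (C * m)) ^ 2 * R)
          + ENNReal.ofReal (r ^ 2) * ENNReal.ofReal ((C * m) ^ 2 * R)) := by
        gcongr
    _ = _ := by
        -- The sign comes from the effective sample size inequality, whose left side is nonnegative.
        have hR : 0 ≤ R := by
          have := sum_weight_sq_le (ξ := ξ) h hκg hN hα hl t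
            (Classical.choice (nonempty_of_isProbabilityMeasure P))
          refine div_nonneg ?_ (Nat.cast_nonneg N)
          refine nonneg_of_mul_nonneg_left ((by positivity : (0 : ℝ) ≤ _).trans this) ?_
          exact pow_pos (sum_weight_pos M y hN hα ξ t _) 2
        rw [← ENNReal.ofReal_mul (by positivity), ← ENNReal.ofReal_add (by positivity)
          (by positivity), ← ENNReal.ofReal_mul (by positivity)]
        congr 1
        field_simp
        ring

theorem integral_empirical (hN : 1 ≤ N) (hα : α ∈ doublyStochastic ℝ (Fin N)) [MeasurableSpace Ω]
    (t : ℕ) {f : X → ℝ} (hf : BoundedMeasurable f) (ω : Ω) :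
    ∫ x, f x ∂empirical M y (fun _ => α) ξ t ω =
      weightedSum M y α ξ t f ω / weightedSum M y α ξ t (fun _ => 1) ω := by
  rw [empirical, integral_finsetSum_measure fun i _ =>
    (hf.integrable _).smul_measure ENNReal.ofReal_ne_top, weightedSum, Finset.sum_div]
  refine Finset.sum_congr rfl fun i _ => ?_
  have hw := weight_pos M y hα ξ t i ω
  have hs := sum_weight_pos M y hN hα ξ t ω
  rw [integral_smul_measure, integral_dirac' _ _ hf.1.stronglyMeasurable, normWeight,
    ENNReal.toReal_ofReal (by positivity), smul_eq_mul, weightedSum]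
  simp only [mul_one]
  ring

/-- The error of the algorithm is the sum of the propagated sampling errors. -/
theorem integral_empirical_sub_integral_filtering [MeasurableSpace Ω]
    (h : M.StrongMixing y κK κg) (hN : 1 ≤ N) (hα : α ∈ doublyStochastic ℝ (Fin N))
    (t : ℕ) {f : X → ℝ} (hf : BoundedMeasurable f) (ω : Ω) :
    ∫ x, f x ∂empirical M y (fun _ => α) ξ t ω - ∫ x, f x ∂M.filtering y t =
      ∑ s ∈ Finset.range (t + 1),
        (weightedSum M y α ξ s (M.backward y (t - s) s f) ω /
          weightedSum M y α ξ s (M.backward y (t - s) s fun _ => 1) ω -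
        predictedSum M y α ξ s (M.backward y (t - s) s f) ω /
          predictedSum M y α ξ s (M.backward y (t - s) s fun _ => 1) ω) := by
  have hN0 : (N : ℝ) ≠ 0 := by positivity
  -- The predicted ratio at time u + 1 is the weighted ratio at time u, so the sum telescopes. At
  -- time 0 the factors N cancel and leave the exact filter.
  have key : ∀ u ≤ t, ∑ s ∈ Finset.range (u + 1),
        (weightedSum M y α ξ s (M.backward y (t - s) s f) ω /
          weightedSum M y α ξ s (M.backward y (t - s) s fun _ => 1) ω -
        predictedSum M y α ξ s (M.backward y (t - s) s f) ω /
          predictedSum M y α ξ s (M.backward y (t - s) s fun _ => 1) ω) =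
      weightedSum M y α ξ u (M.backward y (t - u) u f) ω /
          weightedSum M y α ξ u (M.backward y (t - u) u fun _ => 1) ω -
        ∫ x, f x ∂M.filtering y t := by
    intro u
    induction u with
    | zero =>
      intro _
      rw [h.integral_filtering t hf]
      simp [predictedSum, mul_div_mul_left _ _ hN0]
    | succ u ih =>
      intro hu
      rw [Finset.sum_range_succ, ih (by omega)]
      have e : t - u = t - (u + 1) + 1 := by omega
      have e' : ∀ g : X → ℝ, predictedSum M y α ξ (u + 1) (M.backward y (t - (u + 1)) (u + 1) g) ω
          = weightedSum M y α ξ u (M.backward y (t - u) u g) ω := fun g => by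
        rw [e]; rfl
      rw [e', e']
      ring
  rw [key t le_rfl, integral_empirical hN hα t hf, Nat.sub_self]
  rfl

end AlphaSMC

/-! ### The uniform stability bound. -/

theorem theorem1 {X Y : Type*} [MeasurableSpace X] [MeasurableSpace Y] (M : HMM X Y)
    (κK κg : ℝ) (hκK : 0 < κK) (hκg : 0 < κg) :
    ∃ D ρ : ℝ, 0 < D ∧ 0 < ρ ∧ ρ < 1 ∧
      ∀ y : ℕ → Y, M.StrongMixing y κK κg →
      ∀ N : ℕ, 1 ≤ N → ∀ α : Matrix (Fin N) (Fin N) ℝ, α ∈ doublyStochastic ℝ (Fin N) →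
        UniformIsUniqueInvariant α → mixingConstant α < 1 / κg ^ 2 →
      ∀ {Ω : Type*} [MeasurableSpace Ω] (P : Measure Ω) [IsProbabilityMeasure P]
        (ξ : ℕ → Fin N → Ω → X), AlphaSMC.IsParticleSystem M y (fun _ => α) P ξ →
      ∀ t : ℕ,
        (N : ℝ≥0∞) * tripleNormSq P (AlphaSMC.empirical M y (fun _ => α) ξ t)
            (fun _ => M.filtering y t) ≤
          ENNReal.ofReal (D / (1 - ρ) *
            (κg ^ 4 * (1 - mixingConstant α ^ 2) / (1 - κg ^ 4 * mixingConstant α ^ 2))) := by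

  set ρ := 1 - 1 / (2 * (1 + κK ^ 4)) with hρ
  have hρ0 : 0 < ρ := by
    rw [hρ, sub_pos, div_lt_one (by positivity)]
    nlinarith [pow_pos hκK 4]
  have hρ1 : ρ < 1 := by
    rw [hρ]
    exact sub_lt_self 1 (by positivity)
  have hρ' : 0 < 1 - ρ := by linarith
  set C := 1 + (κg * κK ^ 2) ^ 2 with hC
  have hC0 : 0 < C := by positivity
  -- The summation over time produces (1 - ρ)⁻²; one factor is put into D, the other is displayed in
  -- the statement.
  refine ⟨4 * C ^ 2 / (1 - ρ), ρ, by positivity, hρ0, hρ1, ?_⟩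
  intro y h N hN α hα _ hl Ω _ P _ ξ hξ t
  have hg1 := h.one_le_kg hκg
  have hN0 : (0 : ℝ) < N := by positivity
  set r := (1 - mixingConstant α ^ 2) / (1 - κg ^ 4 * mixingConstant α ^ 2) with hr
  have hr0 : 0 ≤ r := by
    have := AlphaSMC.sum_weight_sq_le (ξ := ξ) h hκg hN hα hl t
      (Classical.choice (nonempty_of_isProbabilityMeasure P))
    refine nonneg_of_mul_nonneg_left ((by positivity : (0 : ℝ) ≤ _).trans this) ?_
    exact pow_pos (AlphaSMC.sum_weight_pos M y hN hα ξ t _) 2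
  have hφ : tripleNormSq P (AlphaSMC.empirical M y (fun _ => α) ξ t) (fun _ => M.filtering y t) ≤
      ENNReal.ofReal (((1 - ρ)⁻¹) ^ 2 * (4 * C ^ 2 * (r / N))) := by
    refine iSup₂_le fun φ hφ => ?_
    have hbm : BoundedMeasurable φ := ⟨hφ.1, 1, hφ.2⟩
    simp only [AlphaSMC.integral_empirical_sub_integral_filtering h hN hα t hbm]
    refine lintegral_sum_geometric_sq_le P hρ0 hρ1 (by positivity) t (fun s => ?_) fun s _ =>
      AlphaSMC.lintegral_propagated_error_le h hκK hκg hN hα hl hξ (t - s) s hφ.1 hφ.2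
    have h1 := (h.boundedMeasurable_backward (t - s) s hbm).1
    have h2 := (h.boundedMeasurable_backward (t - s) s (.const 1)).1
    exact ((AlphaSMC.measurable_weightedSum hξ.measurable s h1).div
      (AlphaSMC.measurable_weightedSum hξ.measurable s h2)).sub
      ((AlphaSMC.measurable_predictedSum hξ.measurable s h1).div
      (AlphaSMC.measurable_predictedSum hξ.measurable s h2))
  calc (N : ℝ≥0∞) * _ ≤ ENNReal.ofReal N *
        ENNReal.ofReal (((1 - ρ)⁻¹) ^ 2 * (4 * C ^ 2 * (r / N))) := by
        rw [ENNReal.ofReal_natCast]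
        exact mul_le_mul_right hφ _
    _ = ENNReal.ofReal (4 * C ^ 2 / (1 - ρ) / (1 - ρ) * r) := by
        rw [← ENNReal.ofReal_mul hN0.le]
        congr 1
        field_simp
    _ ≤ _ := by
        -- The estimate holds without the factor κg⁴, which can be inserted because κg ≥ 1.
        refine ENNReal.ofReal_le_ofReal (mul_le_mul_of_nonneg_left ?_ (by positivity))
        rw [mul_div_assoc]
        exact le_mul_of_one_le_left hr0 (one_le_pow₀ hg1)
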